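/- **Setting.** A timed automaton with inputs and outputs has finitely many locations and clocks, constraints $x\sim n$ ($n\in\mathbb N$) in guards and location invariants, finitely many transitions $e=(l,g,\mathrm{act}(e),X',l')$, and an initial configuration (initial location, all clocks $0$) satisfying its invariant. Configurations are pairs $(l,v)$ with $v\models I(l)$; steps are delays and transitions. In an *open* automaton some clocks are only observed: its transitions do not reset them, but any set of them may be reset along with a transition. The trace of a run erases internal actions and adds up consecutive delays. Let $\mathcal S$ be a specification with restarts: a non-blocking, repeatedly observable timed automaton over inputs $\Sigma_?\cup\{\zeta\}$, outputs $\Sigma_!$ and internal actions, whose $\zeta$-transitions reset all clocks and go to the initial location, and in which from each reachable configuration some run ends with a $\zeta$-transition into the initial configuration. Let $\mathcal{TP}$ be a test purpose: an open automaton over the same actions, observing exactly the clocks of $\mathcal S$, complete (trivial invariants, every action possible in every configuration), whose $\zeta$-transitions reset all its proper clocks and go to its initial location, with a set of accepting locations. Let $\mathcal{DP}$ be an exact determinization of the synchronized product $\mathcal S\times\mathcal{TP}$: a timed automaton without internal actions, with the same finite traces, with the same traces leading to accepting locations, and deterministic: each trace leads to exactly one configuration, and two transitions with the same action whose guards both hold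 in a reachable configuration have the same effect. The objective-centered tester is obtained from $\mathcal{DP}$ by replacing all invariants by true, adding a location $\mathsf{Fail}$ (with a self-loop for each action), and, for every location $l$ and output $a$, transitions labelled $a$ from $l$ to $\mathsf{Fail}$ guarded by a finite set of guards that complements the set of valuations in which $\mathcal{DP}$ has an $a$-transition available at $l$. $\mathbf{Pass}$ is the set of $(l,v)$ with $l$ accepting and $v\models I^{\mathcal{DP}}(l)$; $\mathbf{Fail}$ is the set of $(l,v)$ with $l=\mathsf{Fail}$ or $v\not\models I^{\mathcal{DP}}(l)$. The game $\mathcal G$ is the tester with inputs (including $\zeta$) controllable, $\Sigma_c$, and outputs uncontrollable, $\Sigma_u=\Sigma_!$. Assume that $\mathbf{Pass}$ is reachable in $\mathcal G$ by a run that avoids $\mathbf{Fail}$. Regions are the usual clock regions, for maximal constants that bound the constants of $\mathcal G$ and of the invariants of $\mathcal{DP}$. **Hierarchy.** For sets $V,U$ of configurations, with complement $\overline V$, let $\mathrm{Pred}_B(V)$ be the set of configurations with an enabled transition with action in $B$ into $V$; $\mathrm{tPred}(V,U)$ the set of $(l,v)$ such that for some $\delta\ge0$, $(l,v+\delta)\in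 V$ and $(l,v+\delta')\notin U$ for all $0\le\delta'\le\delta$; and $\mathrm{tPred}(V)=\mathrm{tPred}(V,\emptyset)$. Let $$\pi(V)=\mathrm{tPred}\bigl(V\cup\mathrm{Pred}_{\Sigma_c}(V),\mathrm{Pred}_{\Sigma_u}(\overline V)\bigr)\cup\mathrm{tPred}\bigl(\mathbf{Fail},\mathrm{Pred}_{\Sigma_u}(\overline V)\bigr)\cup\overline{\mathrm{tPred}(\mathrm{Pred}_{\Sigma}(\overline V))},$$ $W^0_0=\mathbf{Pass}$, $W^j_{i+1}=\pi(W^j_i)$, $W^j_\infty=\bigcup_iW^j_i$, $W^{j+1}_0=\mathrm{tPred}(W^j_\infty\cup\mathrm{Pred}_\Sigma(W^j_\infty))$. The rank of $s$ is $(j,i)$ with $j$ least such that $s\in W^j_\infty$, and then $i$ least such that $s\in W^j_i$. Put $W^-(s)=W^j_{i-1}$ if $i>0$; $W^-(s)=W^{j-1}_\infty$ if $i=0<j$; and $W^-(s)=\emptyset$ if the rank is $(0,0)$. **Strategies.** A strategy $f$ is a partial function from finite runs to pairs $(\delta,a)\ne(0,\bot)$, where $\delta\ge 0$ is a possible delay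 and $a=\bot$ or $a\in\Sigma_c$ is possible after $\delta$. The outcomes of $f$ are built from the empty run: if $\rho$ is an outcome and $f(\rho)=(\delta,a)$, extend $\rho$ by a delay $\delta'\le\delta$ and an uncontrollable transition, or by the delay $\delta$, followed by a transition with action $a$ if $a\neq\bot$. An infinite run is an outcome if infinitely many of its prefixes are. The strategy is rank-lowering if, for each finite run ending in a configuration $s\notin\mathbf{Fail}$ that has a rank, $f$ is defined and: - if some delay from $s$ leads into $W^-(s)\cup\mathrm{Pred}_{\Sigma_c}(W^-(s))$, then $f$ selects such a delay $\delta$ that is minimal up to regions (every smaller such delay leads to the same region), with either an $a\in\Sigma_c$ labelling an enabled transition into $W^-(s)$ after $\delta$, or $a=\bot$ if $\delta$ leads into $W^-(s)$; - otherwise $f$ selects $(\delta,\bot)$ with $\delta$ maximal up to regions. **Fairness.** For an infinite run $\rho$, let $\mathrm{Inf}(\rho)$ be the set of regions visited infinitely often by $\rho$, possibly in the course of a delay. The run is fair if 1. for every transition $e$ with uncontrollable action and every $r\in\mathrm{Inf}(\rho)$, if $r\xrightarrow{e}r'$ then $r'\in\mathrm{Inf}(\rho)$; 2. for every $r\in\mathrm{Inf}(\rho)$,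 infinitely often $\rho$ performs a controllable action or a delay in $r$, that is: takes a controllable transition from $r$, or lets time elapse from $r$ to another region, or completes a delay ending in $r$ that is not immediately followed by an uncontrollable transition. **Proposition.** Every rank-lowering strategy is winning on fair runs: every fair infinite run of $\mathcal G$ that is an outcome, from the initial configuration, of a rank-lowering strategy reaches a configuration of $\mathbf{Pass}\cup\mathbf{Fail}$. -/

import Mathlib

open scoped NNReal

namespace TimedTesting

/-! ## Clock constraints and open timed automata with inputs and outputs -/

/-- Valuations of a set of clocks. -/
abbrev Val (X : Type*) := X → ℝ≥0

/-- The valuation `v + d`. -/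
def Val.shift {X : Type*} (v : Val X) (d : ℝ≥0) : Val X := fun x => v x + d

open Classical in
/-- The valuation `v[R ← 0]`. -/
noncomputable def Val.reset {X : Type*} (v : Val X) (R : Set X) : Val X :=
  fun x => if x ∈ R then 0 else v x

/-- Comparison symbols of atomic constraints. -/
inductive Cmp
  | lt | le | eq | ge | gt

/-- Truth of `t ∼ n`. -/
def Cmp.Holds : Cmp → ℝ≥0 → ℕ → Prop
  | .lt, t, n => t < n
  | .le, t, n => t ≤ n
  | .eq, t, n => t = n
  | .ge, t, n => t ≥ n
  | .gt, t, n => t > n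

/-- Atomic constraints `x ∼ n`. -/
structure Atom (X : Type*) where
  clock : X
  cmp : Cmp
  const : ℕ

/-- Clock constraints: finite conjunctions of atomic constraints; `[]` is `true`. -/
abbrev Guard (X : Type*) := List (Atom X)

/-- Satisfaction of a clock constraint. -/
def Guard.Sat {X : Type*} (g : Guard X) (v : Val X) : Prop :=
  ∀ a ∈ g, a.cmp.Holds (v a.clock) a.const

/-- Renaming of the clocks of a constraint. -/
def Guard.rename {X Y : Type*} (i : X → Y) (g : Guard X) : Guard Y :=
  g.map fun a => ⟨i a.clock, a.cmp, a.const⟩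

/-- Actions: inputs, outputs and internal actions. -/
inductive Act (I O T : Type*)
  | inp (a : I)
  | out (a : O)
  | tau (a : T)

theorem Act.finite (I O T : Type*) [Finite I] [Finite O] [Finite T] : Finite (Act I O T) := by
  refine Finite.of_surjective
    (fun x : I ⊕ O ⊕ T => match x with
      | .inl a => (Act.inp a : Act I O T)
      | .inr (.inl a) => .out a
      | .inr (.inr a) => .tau a) ?_
  rintro (a | a | a)
  exacts [⟨.inl a, rfl⟩, ⟨.inr (.inl a), rfl⟩, ⟨.inr (.inr a), rfl⟩]

/-- Transitions `(l, g, a, X', l')`. -/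
@[ext] structure Edge (I O T L X : Type*) where
  src : L
  guard : Guard X
  act : Act I O T
  reset : Set X
  tgt : L

/-- Open timed automata with inputs in `I`, outputs in `O`, internal actions in `T`, locations in
`L` and clocks in `X`; the clocks outside `proper` are the observed ones. -/
structure OTAIO (I O T L X : Type*) where
  init : L
  proper : Set X
  inv : L → Guard X
  edges : Set (Edge I O T L X)
  finite_edges : edges.Finite
  reset_proper : ∀ e ∈ edges, e.reset ⊆ proper
  init_inv : (inv init).Sat (0 : Val X)

/-- Pairs of a location and a valuation. -/
abbrev Config (L X : Type*) := L × Val X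

/-- `(l, v) + d = (l, v + d)`. -/
def Config.shift {L X : Type*} (s : Config L X) (d : ℝ≥0) : Config L X := (s.1, s.2.shift d)

/-- Labels of the semantics: delays, or a transition together with the set of observed clocks that
are reset along with it. -/
inductive Label (I O T L X : Type*)
  | delay (d : ℝ≥0)
  | edge (e : Edge I O T L X) (obs : Set X)

section semantics

variable {I O T L X : Type*}

namespace OTAIO

/-- There are no observed clocks: `A` is a plain timed automaton. -/
def AllProper (A : OTAIO I O T L X) : Prop := A.proper = Set.univ

/-- The configurations of the semantics. -/
def configs (A : OTAIO I O T L X) : Set (Config L X) := {s | (A.inv s.1).Sat s.2}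

/-- The initial configuration. -/
def initConfig (A : OTAIO I O T L X) : Config L X := (A.init, 0)

/-- The transition relation of the semantics. -/
def Step (A : OTAIO I O T L X) (s : Config L X) : Label I O T L X → Config L X → Prop
  | .delay d, s' => s ∈ A.configs ∧ s' ∈ A.configs ∧ s' = s.shift d
  | .edge e obs, s' => s ∈ A.configs ∧ s' ∈ A.configs ∧ e ∈ A.edges ∧ obs ⊆ A.properᶜ ∧
      e.src = s.1 ∧ e.guard.Sat s.2 ∧ s' = (e.tgt, s.2.reset (e.reset ∪ obs))

/-- `A.Path s μ s'`: the labels `μ` lead, along a finite partial run, from `s` to `s'`. -/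
inductive Path (A : OTAIO I O T L X) : Config L X → List (Label I O T L X) → Config L X → Prop
  | nil (s : Config L X) : s ∈ A.configs → Path A s [] s
  | cons {s s' s'' : Config L X} {γ : Label I O T L X} {μ : List (Label I O T L X)} :
      A.Step s γ s' → Path A s' μ s'' → Path A s (γ :: μ) s''

/-- The configurations that are reachable from the initial one. -/
def Reach (A : OTAIO I O T L X) : Set (Config L X) := {s | ∃ μ, A.Path A.initConfig μ s}

end OTAIO

/-- The total duration of a sequence of labels. -/
def duration : List (Label I O T L X) → ℝ≥0
  | [] => 0
  | .delay d :: μ => d + duration μ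
  | .edge _ _ :: μ => duration μ

/-- Traces `d₀ a₀ d₁ a₁ ⋯ dₖ`, consecutive delays being added up: the list of the pairs `(dᵢ, aᵢ)`,
and the last delay. -/
abbrev TimedTrace (I O : Type*) := List (ℝ≥0 × (I ⊕ O)) × ℝ≥0

/-- Prefix a trace by a delay. -/
def TimedTrace.addDelay {I O : Type*} (d : ℝ≥0) : TimedTrace I O → TimedTrace I O
  | ([], r) => ([], d + r)
  | ((d', a) :: w, r) => ((d + d', a) :: w, r)

/-- The trace of a sequence: internal actions are erased. -/
noncomputable def trace : List (Label I O T L X) → TimedTrace I O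
  | [] => ([], 0)
  | .delay d :: μ => (trace μ).addDelay d
  | .edge e _ :: μ => match e.act with
    | .inp a => ((0, .inl a) :: (trace μ).1, (trace μ).2)
    | .out a => ((0, .inr a) :: (trace μ).1, (trace μ).2)
    | .tau _ => trace μ

namespace OTAIO

/-- The configurations that can be reached when `σ` has been observed. -/
def after (A : OTAIO I O T L X) (σ : TimedTrace I O) : Set (Config L X) :=
  {s | ∃ μ, A.Path A.initConfig μ s ∧ trace μ = σ}

/-- The (finite) traces. -/
def Traces (A : OTAIO I O T L X) : Set (TimedTrace I O) := {σ | (A.after σ).Nonempty}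

/-- The traces that can lead to a location of `Acc`. -/
def AcceptedTraces (A : OTAIO I O T L X) (Acc : Set L) : Set (TimedTrace I O) :=
  {σ | ∃ s ∈ A.after σ, s.1 ∈ Acc}

def Deterministic (A : OTAIO I O T L X) : Prop := ∀ σ ∈ A.Traces, ∃ s, A.after σ = {s}

def Complete (A : OTAIO I O T L X) : Prop :=
  (∀ s, s ∈ A.configs) ∧ ∀ s a, ∃ e obs s', e.act = a ∧ A.Step s (.edge e obs) s'

/-- Whatever the delay, it can elapse without the help of input actions. -/
def NonBlocking (A : OTAIO I O T L X) : Prop :=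
  ∀ s ∈ A.Reach, ∀ t : ℝ≥0, ∃ μ s', A.Path s μ s' ∧ duration μ = t ∧
    ∀ e obs, Label.edge e obs ∈ μ → ∀ a, e.act ≠ .inp a

def RepeatedlyObservable (A : OTAIO I O T L X) : Prop :=
  ∀ s ∈ A.Reach, ∃ μ s', A.Path s μ s' ∧ (trace μ).1 ≠ []

end OTAIO

end semantics

/-! ## Specifications, test purposes, their product and its exact determinization

The inputs are `Option In`: `none` is the restart action, `some a` is an ordinary input `a`. -/

section artifacts

variable {In Out Tau LS XS LT XT LD XD : Type*}

/-- Specifications with restarts. -/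
structure IsSpecification (S : OTAIO (Option In) Out Tau LS XS) : Prop where
  proper_eq_univ : S.AllProper
  nonBlocking : S.NonBlocking
  repeatedlyObservable : S.RepeatedlyObservable
  restart : ∀ e ∈ S.edges, e.act = .inp none → e.reset = S.proper ∧ e.tgt = S.init
  restart_reachable : ∀ s ∈ S.Reach, ∃ μ s' e obs, S.Path s μ s' ∧ e.act = .inp none ∧
    S.Step s' (.edge e obs) S.initConfig

/-- Test purposes for a specification with set of clocks `XS`: their proper clocks are the elements
of `XT`, and the elements of `XS` are observed. -/
structure IsTestPurpose (P : OTAIO (Option In) Out Tau LT (XT ⊕ XS)) : Prop where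
  proper : P.proper = Set.range Sum.inl
  complete : P.Complete
  restart : ∀ e ∈ P.edges, e.act = .inp none → e.reset = P.proper ∧ e.tgt = P.init

theorem Guard.sat_rename_zero {X Y : Type*} (i : X → Y) (g : Guard X) (h : g.Sat (0 : Val X)) :
    (g.rename i).Sat (0 : Val Y) := by
  intro a ha
  obtain ⟨b, hb, rfl⟩ := List.mem_map.1 ha
  exact h b hb

/-- Synchronization of two transitions. -/
def syncEdge (p : Edge (Option In) Out Tau LS XS × Edge (Option In) Out Tau LT (XT ⊕ XS)) :
    Edge (Option In) Out Tau (LS × LT) (XT ⊕ XS) where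
  src := (p.1.src, p.2.src)
  guard := p.1.guard.rename Sum.inr ++ p.2.guard
  act := p.1.act
  reset := Sum.inr '' p.1.reset ∪ p.2.reset
  tgt := (p.1.tgt, p.2.tgt)

/-- The product of a specification and a test purpose; all its clocks are proper. -/
def product (S : OTAIO (Option In) Out Tau LS XS) (P : OTAIO (Option In) Out Tau LT (XT ⊕ XS)) :
    OTAIO (Option In) Out Tau (LS × LT) (XT ⊕ XS) where
  init := (S.init, P.init)
  proper := Set.univ
  inv l := (S.inv l.1).rename Sum.inr ++ P.inv l.2
  edges := syncEdge '' {p | p.1 ∈ S.edges ∧ p.2 ∈ P.edges ∧ p.1.act = p.2.act}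
  finite_edges := ((S.finite_edges.prod P.finite_edges).subset
    fun _ hp => ⟨hp.1, hp.2.1⟩).image _
  reset_proper _ _ := Set.subset_univ _
  init_inv := by
    intro a ha
    rcases List.mem_append.1 ha with h | h
    · exact Guard.sat_rename_zero _ _ S.init_inv a h
    · exact P.init_inv a h

/-- `D`, with accepting locations `AccD`, is an exact determinization of `A`, with accepting
locations `Acc`. That `D` has no internal actions is expressed by its type. -/
structure IsExactDeterminization {L X : Type*} (A : OTAIO (Option In) Out Tau L X) (Acc : Set L)
    (D : OTAIO (Option In) Out Empty LD XD) (AccD : Set LD) : Prop where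
  proper_eq_univ : D.AllProper
  deterministic : D.Deterministic
  traces : D.Traces = A.Traces
  accepted : D.AcceptedTraces AccD = A.AcceptedTraces Acc

/-- In a reachable configuration, two transitions with the same action whose guards are satisfied
have the same effect. -/
def GuardDeterministic {I O T L X : Type*} (A : OTAIO I O T L X) : Prop :=
  ∀ s ∈ A.Reach, ∀ e ∈ A.edges, ∀ e' ∈ A.edges, e.src = s.1 → e'.src = s.1 → e.act = e'.act →
    e.guard.Sat s.2 → e'.guard.Sat s.2 →
      e.tgt = e'.tgt ∧ s.2.reset e.reset = s.2.reset e'.reset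

end artifacts

/-! ## The objective-centered tester -/

section tester

variable {I O L X : Type*}

/-- Timed game automata: the inputs are controllable, the outputs are uncontrollable. -/
abbrev TGA (I O L X : Type*) := OTAIO I O Empty L X

/-- For each location `l` and output `a`, a finite set of guards complementing the set of the
valuations in which an `a`-transition is available. -/
structure OutputComplement (D : OTAIO I O Empty L X) where
  guards : L → O → Set (Guard X)
  finite_guards : ∀ l a, (guards l a).Finite
  spec : ∀ l a v, (∃ g ∈ guards l a, Guard.Sat g v) ↔
    ¬ ∃ e obs s', e.act = .out a ∧ D.Step (l, v) (.edge e obs) s'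

/-- A transition of the determinization, as a transition of the tester. -/
def liftEdge (e : Edge I O Empty L X) : Edge I O Empty (Option L) X :=
  ⟨some e.src, e.guard, e.act, e.reset, some e.tgt⟩

/-- The objective-centered tester, seen as a timed game automaton. The location `none` is `Fail`. -/
def tester [Finite I] [Finite O] [Finite L] (D : OTAIO I O Empty L X) (C : OutputComplement D) :
    TGA I O (Option L) X where
  init := some D.init
  proper := D.proper
  inv _ := []
  edges := liftEdge '' D.edges ∪
    (⋃ p : L × O, (fun g : Guard X => ⟨some p.1, g, .out p.2, ∅, none⟩) '' C.guards p.1 p.2) ∪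
    Set.range fun a : Act I O Empty => ⟨none, [], a, ∅, none⟩
  finite_edges := by
    have := Act.finite I O Empty
    exact ((D.finite_edges.image _).union
      (Set.finite_iUnion fun p : L × O => (C.finite_guards p.1 p.2).image _)).union (Set.finite_range _)
  reset_proper := by
    rintro e ((⟨e', he, rfl⟩ | he) | ⟨a, rfl⟩)
    · exact D.reset_proper e' he
    · obtain ⟨p, g, _, rfl⟩ := Set.mem_iUnion.1 he
      exact Set.empty_subset _
    · exact Set.empty_subset _
  init_inv := fun a ha => absurd ha List.not_mem_nil

/-- The verdict `Pass`. -/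
def passSet (D : OTAIO I O Empty L X) (AccD : Set L) : Set (Config (Option L) X) :=
  {s | ∃ l ∈ AccD, s.1 = some l ∧ (D.inv l).Sat s.2}

/-- The verdict `Fail`. -/
def failSet (D : OTAIO I O Empty L X) : Set (Config (Option L) X) :=
  {s | s.1 = none ∨ ∃ l, s.1 = some l ∧ ¬ (D.inv l).Sat s.2}

end tester

/-! ## Runs, strategies and outcomes -/

section games

variable {I O L X : Type*}

/-- Finite sequences of labels and configurations from a first configuration. -/
structure FinRun (I O L X : Type*) where
  first : Config L X
  steps : List (Label I O Empty L X × Config L X)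

namespace FinRun

/-- The last configuration. -/
def last (ρ : FinRun I O L X) : Config L X := (ρ.steps.map Prod.snd).getLastD ρ.first

/-- Extension by one step. -/
def snoc (ρ : FinRun I O L X) (γ : Label I O Empty L X) (s : Config L X) : FinRun I O L X :=
  ⟨ρ.first, ρ.steps ++ [(γ, s)]⟩

/-- The steps listed are steps of `G`, from `s` on. -/
def ValidFrom (G : TGA I O L X) :
    Config L X → List (Label I O Empty L X × Config L X) → Prop
  | _, [] => True
  | s, (γ, s') :: l => G.Step s γ s' ∧ ValidFrom G s' l

/-- `ρ` is a finite run of `G`. -/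
def IsRun (G : TGA I O L X) (ρ : FinRun I O L X) : Prop :=
  ρ.first = G.initConfig ∧ ValidFrom G ρ.first ρ.steps

end FinRun

/-- Infinite runs of `G`. -/
structure InfRun (G : TGA I O L X) where
  state : ℕ → Config L X
  label : ℕ → Label I O Empty L X
  state_zero : state 0 = G.initConfig
  step : ∀ i, G.Step (state i) (label i) (state (i + 1))

/-- The prefix consisting of the first `n` steps. -/
def InfRun.take {G : TGA I O L X} (ρ : InfRun G) (n : ℕ) : FinRun I O L X :=
  ⟨ρ.state 0, (List.range n).map fun i => (ρ.label i, ρ.state (i + 1))⟩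

/-- The run visits a configuration of `V`; it is a finite run ending in `V`, if cut there. -/
def InfRun.Reaches {G : TGA I O L X} (ρ : InfRun G) (V : Set (Config L X)) : Prop :=
  ∃ i, ρ.state i ∈ V

/-- Reachability by runs that avoid `V`. -/
inductive ReachAvoiding (G : TGA I O L X) (V : Set (Config L X)) : Config L X → Prop
  | init : G.initConfig ∉ V → ReachAvoiding G V G.initConfig
  | step {s s' : Config L X} {γ : Label I O Empty L X} :
      ReachAvoiding G V s → G.Step s γ s' → s' ∉ V → ReachAvoiding G V s'

/-- Partial functions from finite runs to pairs of a delay and either a controllable action or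
`⊥`, which is `none`. -/
abbrev Strat (I O L X : Type*) := FinRun I O L X → Option (ℝ≥0 × Option I)

/-- The moves proposed by a strategy have to be possible, and `(0, ⊥)` is excluded. -/
def IsStrategy (G : TGA I O L X) (f : Strat I O L X) : Prop :=
  ∀ ρ, ρ.IsRun G → ∀ δ a, f ρ = some (δ, a) → (δ, a) ≠ (0, none) ∧
    G.Step ρ.last (.delay δ) (ρ.last.shift δ) ∧
    ∀ c, a = some c → ∃ e s', e.act = .inp c ∧ G.Step (ρ.last.shift δ) (.edge e ∅) s'

/-- The finite outcomes of `f` from `s`. -/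
inductive Outcome (G : TGA I O L X) (f : Strat I O L X) (s : Config L X) : FinRun I O L X → Prop
  | nil : Outcome G f s ⟨s, []⟩
  | uncontrollable {ρ : FinRun I O L X} {δ δ' : ℝ≥0} {a : Option I} {b : O}
      {e : Edge I O Empty L X} {s₁ s₂ : Config L X} :
      Outcome G f s ρ → f ρ = some (δ, a) → δ' ≤ δ → G.Step ρ.last (.delay δ') s₁ →
      e.act = .out b → G.Step s₁ (.edge e ∅) s₂ →
      Outcome G f s ((ρ.snoc (.delay δ') s₁).snoc (.edge e ∅) s₂)
  | wait {ρ : FinRun I O L X} {δ : ℝ≥0} {s₁ : Config L X} :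
      Outcome G f s ρ → f ρ = some (δ, none) → G.Step ρ.last (.delay δ) s₁ →
      Outcome G f s (ρ.snoc (.delay δ) s₁)
  | controllable {ρ : FinRun I O L X} {δ : ℝ≥0} {c : I}
      {e : Edge I O Empty L X} {s₁ s₂ : Config L X} :
      Outcome G f s ρ → f ρ = some (δ, some c) → G.Step ρ.last (.delay δ) s₁ →
      e.act = .inp c → G.Step s₁ (.edge e ∅) s₂ →
      Outcome G f s ((ρ.snoc (.delay δ) s₁).snoc (.edge e ∅) s₂)

/-- Infinite outcomes from the initial configuration: infinitely many prefixes are outcomes. -/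
def InfRun.IsOutcome {G : TGA I O L X} (ρ : InfRun G) (f : Strat I O L X) : Prop :=
  ∃ᶠ n in Filter.atTop, Outcome G f G.initConfig (ρ.take n)

/-! ## Predecessors and the hierarchy -/

/-- Discrete predecessors of `V` by the actions in `B`. -/
def dPred (G : TGA I O L X) (B : Set (Act I O Empty)) (V : Set (Config L X)) :
    Set (Config L X) :=
  {s | ∃ e ∈ G.edges, e.act ∈ B ∧ e.src = s.1 ∧ e.guard.Sat s.2 ∧ (e.tgt, s.2.reset e.reset) ∈ V}

/-- Predecessors by the controllable actions. -/
def cPred (G : TGA I O L X) (V : Set (Config L X)) : Set (Config L X) :=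
  dPred G (Set.range Act.inp) V

/-- Predecessors by the uncontrollable actions. -/
def uPred (G : TGA I O L X) (V : Set (Config L X)) : Set (Config L X) :=
  dPred G (Set.range Act.out) V

/-- Timed predecessors of `V`, while avoiding `U`. -/
def tPred (V U : Set (Config L X)) : Set (Config L X) :=
  {s | ∃ δ : ℝ≥0, s.shift δ ∈ V ∧ ∀ δ' ≤ δ, s.shift δ' ∉ U}

/-- Final timed predecessors. -/
def ftPred (G : TGA I O L X) (fail V : Set (Config L X)) : Set (Config L X) :=
  tPred fail (uPred G Vᶜ) ∪ (tPred (dPred G Set.univ Vᶜ) ∅)ᶜ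

/-- The operator `π`. -/
def piOp (G : TGA I O L X) (fail V : Set (Config L X)) : Set (Config L X) :=
  tPred (V ∪ cPred G V) (uPred G Vᶜ) ∪ ftPred G fail V

/-- The sets `W^j_0`. -/
def WBase (G : TGA I O L X) (pass fail : Set (Config L X)) : ℕ → Set (Config L X)
  | 0 => pass
  | j + 1 => tPred ((⋃ i, (piOp G fail)^[i] (WBase G pass fail j)) ∪
      dPred G Set.univ (⋃ i, (piOp G fail)^[i] (WBase G pass fail j))) ∅

/-- The sets `W^j_i`. -/
def W (G : TGA I O L X) (pass fail : Set (Config L X)) (j i : ℕ) : Set (Config L X) :=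
  (piOp G fail)^[i] (WBase G pass fail j)

/-- The sets `W^j_∞`. -/
def WInf (G : TGA I O L X) (pass fail : Set (Config L X)) (j : ℕ) : Set (Config L X) :=
  ⋃ i, W G pass fail j i

/-- `s` has rank `(j, i)`. -/
def HasRank (G : TGA I O L X) (pass fail : Set (Config L X)) (s : Config L X) (j i : ℕ) : Prop :=
  (s ∈ WInf G pass fail j ∧ ∀ j' < j, s ∉ WInf G pass fail j') ∧
    s ∈ W G pass fail j i ∧ ∀ i' < i, s ∉ W G pass fail j i'

/-- The set `W⁻(s)` when `s` has rank `(j, i)`: the set of the hierarchy just below. -/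
def WMinus (G : TGA I O L X) (pass fail : Set (Config L X)) : ℕ → ℕ → Set (Config L X)
  | j, i + 1 => W G pass fail j i
  | j + 1, 0 => WInf G pass fail j
  | 0, 0 => ∅

/-! ## Clock regions -/

/-- The fractional part of a clock. -/
noncomputable def frac (t : ℝ≥0) : ℝ := Int.fract (t : ℝ)

/-- Region equivalence of valuations, for the maximal constants `M`. -/
def RegEq (M : X → ℕ) (v w : Val X) : Prop :=
  (∀ x, (⌊v x⌋₊ = ⌊w x⌋₊ ∧ (v x ≤ M x ↔ w x ≤ M x)) ∨ ((M x : ℝ≥0) < v x ∧ (M x : ℝ≥0) < w x)) ∧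
  (∀ x, v x ≤ M x → (frac (v x) = 0 ↔ frac (w x) = 0)) ∧
  ∀ x y, v x ≤ M x → v y ≤ M y → (frac (v x) ≤ frac (v y) ↔ frac (w x) ≤ frac (w y))

/-- The clock region of a configuration. -/
def region (M : X → ℕ) (s : Config L X) : Set (Config L X) :=
  {t | t.1 = s.1 ∧ RegEq M s.2 t.2}

/-- The constants that are compared with each clock `x` in `g` are at most `M x`. -/
def Guard.BoundedBy (M : X → ℕ) (g : Guard X) : Prop := ∀ a ∈ g, a.const ≤ M a.clock

/-! ## Rank-lowering strategies -/

/-- The delays after which `V` is reached, either at once or by some controllable transition. -/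
def candidates (G : TGA I O L X) (V : Set (Config L X)) (s : Config L X) : Set ℝ≥0 :=
  {δ | s.shift δ ∈ cPred G V ∪ V}

/-- Rank-lowering strategies. If some delay leads to `W⁻(s)`, or to a configuration with a
controllable transition to `W⁻(s)`, then the strategy selects such a delay that is minimal (up to
regions), with the corresponding action; otherwise it waits for a maximal delay (up to
regions). -/
def RankLowering (G : TGA I O L X) (pass fail : Set (Config L X)) (M : X → ℕ)
    (f : Strat I O L X) : Prop :=
  ∀ ρ : FinRun I O L X, ρ.IsRun G → ρ.last ∉ fail → ∀ j i, HasRank G pass fail ρ.last j i →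
    ∃ δ a, f ρ = some (δ, a) ∧
      ((candidates G (WMinus G pass fail j i) ρ.last).Nonempty →
        (∀ c, a = some c → ρ.last.shift δ ∈ dPred G {.inp c} (WMinus G pass fail j i)) ∧
        (a = none → ρ.last.shift δ ∈ WMinus G pass fail j i) ∧
        ∀ δ' ∈ candidates G (WMinus G pass fail j i) ρ.last, δ' ≤ δ →
          RegEq M (ρ.last.2.shift δ) (ρ.last.2.shift δ')) ∧
      (candidates G (WMinus G pass fail j i) ρ.last = ∅ →
        a = none ∧ ∀ δ', δ ≤ δ' → RegEq M (ρ.last.2.shift δ) (ρ.last.2.shift δ'))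

/-! ## Fairness -/

/-- The label is a transition with a controllable action. -/
def Label.Controllable : Label I O Empty L X → Prop
  | .delay _ => False
  | .edge e _ => ∃ c, e.act = .inp c

/-- The label is a transition with an uncontrollable action. -/
def Label.Uncontrollable : Label I O Empty L X → Prop
  | .delay _ => False
  | .edge e _ => ∃ b, e.act = .out b

/-- The infinite support: the regions that appear infinitely often, possibly in the course of a
delay. -/
def infSupport (M : X → ℕ) {G : TGA I O L X} (ρ : InfRun G) : Set (Set (Config L X)) :=
  {r | (∃ s, r = region M s) ∧ ∃ᶠ i in Filter.atTop, ρ.state i ∈ r ∨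
    ∃ γ δ, ρ.label i = .delay γ ∧ δ < γ ∧ (ρ.state i).shift δ ∈ r}

/-- At its `i`-th step, in the region `r`, the run performs a controllable action or a delay: it
takes a controllable transition, or time elapses from `r` to another region, or a delay that ends
in `r` elapses completely, without being interrupted by an uncontrollable action. -/
def LetsPlay {G : TGA I O L X} (ρ : InfRun G) (r : Set (Config L X)) (i : ℕ) : Prop :=
  (ρ.state i ∈ r ∧ (ρ.label i).Controllable) ∨
  ∃ γ, ρ.label i = .delay γ ∧
    ((∃ δ δ', δ < δ' ∧ δ' ≤ γ ∧ (ρ.state i).shift δ ∈ r ∧ (ρ.state i).shift δ' ∉ r) ∨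
      (ρ.state (i + 1) ∈ r ∧ ¬ (ρ.label (i + 1)).Uncontrollable))

/-- Fair runs. -/
def Fair (M : X → ℕ) {G : TGA I O L X} (ρ : InfRun G) : Prop :=
  (∀ e ∈ G.edges, (∃ b, e.act = .out b) → ∀ r ∈ infSupport M ρ, ∀ s ∈ r, ∀ s',
    G.Step s (.edge e ∅) s' → region M s' ∈ infSupport M ρ) ∧
  ∀ r ∈ infSupport M ρ, ∃ᶠ i in Filter.atTop, LetsPlay ρ r i

end games

end TimedTesting

open TimedTesting

namespace TimedTesting

/-! ## Region equivalence -/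

section regions

variable {X L I O : Type*}

/-! All sets of the hierarchy are unions of clock regions, and there are finitely many regions.
Hence from some step on a run meets only regions of its infinite support (`exists_isTail`). Consider
a fair outcome that avoids both Fail and Pass.

First, every configuration it visits has a rank. Outside Fail a step of the tester is a step of `D`,
so the run stays in reachable configurations of `D`. In the product, a ζ-transition can always bring
the run back to the initial configuration, because the test purpose is complete and can follow the
specification; from there an accepted trace can be replayed. Equality of traces and of accepted
traces, together with determinism, turns this into a path of `D` to an accepting location
(`exists_path_accepting`), and each step of that path costs at most one level `j`
(`mem_WInf_of_path`).

Now take the least `j` for which the infinite support meets `W^j_∞`. Fairness and the minimality of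
the chosen delays force a decision, that is, the beginning of a delay, in `W^j_∞`
(`exists_delay_mem_WInf`). In the tail no lower level is met, so a decision in `W^j_{i+1}` either
has a lower index or aims at `W^j_i`; the three clauses of `π` then exclude that the run never
descends, and it reaches `W^j_0` (`exists_mem_W_zero`). If `j = m + 1`, a region of the support
inside `W^j_0` that is as late as possible in time yields, by fairness, a region of the support
inside `W^m_∞` (`exists_mem_WInf_of_mem_W_zero`), against the choice of `j`. So `j = 0`, and `W^0_0`
is Pass.

Region equivalence is handled through `DiagEq`, whose conditions are linear inequalities with
integer constants: delays, resets and guards then reduce to linear arithmetic. -/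

theorem floor_add_frac (t : ℝ≥0) :
    (t : ℝ) = (⌊t⌋₊ : ℝ) + frac t ∧ 0 ≤ frac t ∧ frac t < 1 := by
  refine ⟨?_, Int.fract_nonneg _, Int.fract_lt_one _⟩
  have h : ⌊(t : ℝ)⌋ = (⌊t⌋₊ : ℤ) := by
    rw [Int.floor_eq_iff]
    have h1 := Nat.floor_le t.2
    have h2 := Nat.lt_floor_add_one t
    exact ⟨by exact_mod_cast h1, by exact_mod_cast h2⟩
  have h' := Int.floor_add_fract (t : ℝ)
  rw [h] at h'
  exact_mod_cast h'.symm

/-- Region equivalence by means of thresholds and differences. -/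
structure DiagEq (M : X → ℕ) (v w : Val X) : Prop where
  le : ∀ x, ∀ k : ℕ, k ≤ M x → ((v x : ℝ) ≤ k ↔ (w x : ℝ) ≤ k)
  ge : ∀ x, ∀ k : ℕ, k ≤ M x → ((k : ℝ) ≤ v x ↔ (k : ℝ) ≤ w x)
  diff : ∀ x y, (v x : ℝ) ≤ M x → (v y : ℝ) ≤ M y →
    ∀ m : ℤ, ((v x : ℝ) - v y ≤ m ↔ (w x : ℝ) - w y ≤ m)

namespace DiagEq

variable {M : X → ℕ} {u v w : Val X}

theorem refl (v : Val X) : DiagEq M v v :=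
  ⟨fun _ _ _ => Iff.rfl, fun _ _ _ => Iff.rfl, fun _ _ _ _ _ => Iff.rfl⟩

theorem symm (h : DiagEq M v w) : DiagEq M w v :=
  ⟨fun x k hk => (h.le x k hk).symm, fun x k hk => (h.ge x k hk).symm, fun x y hx hy m =>
    (h.diff x y ((h.le x _ le_rfl).2 hx) ((h.le y _ le_rfl).2 hy) m).symm⟩

theorem trans (h : DiagEq M u v) (h' : DiagEq M v w) : DiagEq M u w :=
  ⟨fun x k hk => (h.le x k hk).trans (h'.le x k hk),
    fun x k hk => (h.ge x k hk).trans (h'.ge x k hk), fun x y hx hy m =>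
    (h.diff x y hx hy m).trans
      (h'.diff x y ((h.le x _ le_rfl).1 hx) ((h.le y _ le_rfl).1 hy) m)⟩

end DiagEq

/-- Below the maximal constant the integer part is the largest threshold reached, and fractional
parts are compared by comparing `v x - v y` with the difference of the integer parts. -/
theorem regEq_of_diagEq {M : X → ℕ} {v w : Val X} (h : DiagEq M v w) : RegEq M v w := by
  have key : ∀ x, (v x : ℝ) ≤ M x → ⌊v x⌋₊ = ⌊w x⌋₊ := by
    intro x hx
    have hw := (h.le x _ le_rfl).1 hx
    have aux : ∀ {a b : ℝ≥0}, (a : ℝ) ≤ M x →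
        (∀ k : ℕ, k ≤ M x → ((k : ℝ) ≤ a → (k : ℝ) ≤ b)) → ⌊a⌋₊ ≤ ⌊b⌋₊ := by
      intro a b ha hab
      obtain ⟨e, h0, -⟩ := floor_add_frac a
      refine Nat.le_floor ?_
      have hk : (⌊a⌋₊ : ℝ) ≤ a := by linarith
      have := hab ⌊a⌋₊ (by exact_mod_cast hk.trans ha) hk
      exact_mod_cast this
    exact le_antisymm (aux hx fun k hk => (h.ge x k hk).1) (aux hw fun k hk => (h.ge x k hk).2)
  refine ⟨fun x => ?_, fun x hx => ?_, fun x y hx hy => ?_⟩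
  · by_cases hx : (v x : ℝ) ≤ M x
    · refine .inl ⟨key x hx, ?_⟩
      have := h.le x _ le_rfl
      exact_mod_cast this
    · refine .inr ⟨?_, ?_⟩
      · exact_mod_cast not_le.1 hx
      · exact_mod_cast not_le.1 (mt (h.le x _ le_rfl).2 hx)
  · have hx' : (v x : ℝ) ≤ M x := by exact_mod_cast hx
    have e := key x hx'
    obtain ⟨e1, h1, -⟩ := floor_add_frac (v x)
    obtain ⟨e2, h2, -⟩ := floor_add_frac (w x)
    have hk : ⌊v x⌋₊ ≤ M x := by
      have : (⌊v x⌋₊ : ℝ) ≤ M x := by linarith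
      exact_mod_cast this
    have := h.le x _ hk
    rw [← e] at e2
    constructor <;> intro h0
    · have := this.1 (by linarith); linarith
    · have := this.2 (by linarith); linarith
  · have hx' : (v x : ℝ) ≤ M x := by exact_mod_cast hx
    have hy' : (v y : ℝ) ≤ M y := by exact_mod_cast hy
    obtain ⟨e1, -, -⟩ := floor_add_frac (v x)
    obtain ⟨e2, -, -⟩ := floor_add_frac (w x)
    obtain ⟨e3, -, -⟩ := floor_add_frac (v y)
    obtain ⟨e4, -, -⟩ := floor_add_frac (w y)
    rw [← key x hx'] at e2
    rw [← key y hy'] at e4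
    have := h.diff x y hx' hy' ((⌊v x⌋₊ : ℤ) - (⌊v y⌋₊ : ℤ))
    push_cast at this
    constructor <;> intro h0
    · have := this.1 (by linarith); linarith
    · have := this.2 (by linarith); linarith

/-- Only the threshold equal to the integer part, or to the difference of the integer parts, needs
the fractional parts; any other integer is decided by the integer parts alone. -/
theorem diagEq_of_regEq {M : X → ℕ} {v w : Val X} (h : RegEq M v w) : DiagEq M v w := by
  obtain ⟨h1, h2, h3⟩ := h
  have big : ∀ x, ¬ (v x : ℝ) ≤ M x → ¬ (w x : ℝ) ≤ M x := by
    intro x hx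
    rcases h1 x with ⟨-, h⟩ | ⟨-, h⟩
    · intro hw
      exact hx (by exact_mod_cast h.2 (by exact_mod_cast hw))
    · rw [not_le]; exact_mod_cast h
  have small : ∀ x, (v x : ℝ) ≤ M x → ⌊v x⌋₊ = ⌊w x⌋₊ ∧ (w x : ℝ) ≤ M x ∧
      (frac (v x) = 0 ↔ frac (w x) = 0) := by
    intro x hx
    have hx' : v x ≤ M x := by exact_mod_cast hx
    rcases h1 x with ⟨h, h'⟩ | ⟨h, -⟩
    · exact ⟨h, by exact_mod_cast h'.1 hx', h2 x hx'⟩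
    · exact absurd hx' (not_le.2 h)
  refine ⟨fun x k hk => ?_, fun x k hk => ?_, fun x y hx hy m => ?_⟩
  · have hkM : (k : ℝ) ≤ M x := by exact_mod_cast hk
    by_cases hx : (v x : ℝ) ≤ M x
    · obtain ⟨e, -, h0⟩ := small x hx
      obtain ⟨e1, p1, q1⟩ := floor_add_frac (v x)
      obtain ⟨e2, p2, q2⟩ := floor_add_frac (w x)
      rw [← e] at e2
      rcases lt_trichotomy ⌊v x⌋₊ k with hlt | heq | hgt
      · have : (⌊v x⌋₊ : ℝ) + 1 ≤ k := by exact_mod_cast hlt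
        exact iff_of_true (by linarith) (by linarith)
      · have heq' : (⌊v x⌋₊ : ℝ) = k := by exact_mod_cast heq
        constructor <;> intro h
        · have := h0.1 (by linarith); linarith
        · have := h0.2 (by linarith); linarith
      · have : (k : ℝ) + 1 ≤ ⌊v x⌋₊ := by exact_mod_cast hgt
        exact iff_of_false (by linarith) (by linarith)
    · have := big x hx
      rw [not_le] at hx this
      exact iff_of_false (by linarith) (by linarith)
  · have hkM : (k : ℝ) ≤ M x := by exact_mod_cast hk
    by_cases hx : (v x : ℝ) ≤ M x
    · obtain ⟨e, -, -⟩ := small x hx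
      obtain ⟨e1, p1, q1⟩ := floor_add_frac (v x)
      obtain ⟨e2, p2, q2⟩ := floor_add_frac (w x)
      rw [← e] at e2
      rcases lt_or_ge ⌊v x⌋₊ k with hlt | hge
      · have : (⌊v x⌋₊ : ℝ) + 1 ≤ k := by exact_mod_cast hlt
        exact iff_of_false (by linarith) (by linarith)
      · have : (k : ℝ) ≤ ⌊v x⌋₊ := by exact_mod_cast hge
        exact iff_of_true (by linarith) (by linarith)
    · have := big x hx
      rw [not_le] at hx this
      exact iff_of_true (by linarith) (by linarith)
  · obtain ⟨ex, -, -⟩ := small x hx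
    obtain ⟨ey, -, -⟩ := small y hy
    have h3 := h3 x y (by exact_mod_cast hx) (by exact_mod_cast hy)
    obtain ⟨e1, p1, q1⟩ := floor_add_frac (v x)
    obtain ⟨e2, p2, q2⟩ := floor_add_frac (w x)
    obtain ⟨e3, p3, q3⟩ := floor_add_frac (v y)
    obtain ⟨e4, p4, q4⟩ := floor_add_frac (w y)
    rw [← ex] at e2
    rw [← ey] at e4
    rcases lt_trichotomy ((⌊v x⌋₊ : ℤ) - ⌊v y⌋₊) m with hlt | heq | hgt
    · have : ((⌊v x⌋₊ : ℝ) - ⌊v y⌋₊) + 1 ≤ m := by exact_mod_cast hlt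
      exact iff_of_true (by linarith) (by linarith)
    · have : ((⌊v x⌋₊ : ℝ) - ⌊v y⌋₊) = m := by exact_mod_cast heq
      constructor <;> intro h
      · have := h3.1 (by linarith); linarith
      · have := h3.2 (by linarith); linarith
    · have : (m : ℝ) + 1 ≤ ((⌊v x⌋₊ : ℝ) - ⌊v y⌋₊) := by exact_mod_cast hgt
      exact iff_of_false (by linarith) (by linarith)

theorem regEq_iff {M : X → ℕ} {v w : Val X} : RegEq M v w ↔ DiagEq M v w :=
  ⟨diagEq_of_regEq, regEq_of_diagEq⟩

namespace RegEq

variable {M : X → ℕ} {u v w : Val X}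

theorem refl (v : Val X) : RegEq M v v := regEq_iff.2 (.refl v)

theorem symm (h : RegEq M v w) : RegEq M w v := regEq_iff.2 (regEq_iff.1 h).symm

theorem trans (h : RegEq M u v) (h' : RegEq M v w) : RegEq M u w :=
  regEq_iff.2 ((regEq_iff.1 h).trans (regEq_iff.1 h'))

end RegEq

/-! ### Delays, resets and guards modulo region equivalence -/

@[simp] theorem Val.coe_shift (v : Val X) (d : ℝ≥0) (x : X) :
    ((v.shift d x : ℝ≥0) : ℝ) = v x + d := by simp [Val.shift]

theorem Val.shift_shift (v : Val X) (d e : ℝ≥0) : (v.shift d).shift e = v.shift (d + e) := by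
  funext x; simp [Val.shift, add_assoc]

@[simp] theorem Val.shift_zero (v : Val X) : v.shift 0 = v := by
  funext x; simp [Val.shift]

theorem Config.shift_shift (s : Config L X) (d e : ℝ≥0) :
    (s.shift d).shift e = s.shift (d + e) := by
  simp [Config.shift, Val.shift_shift]

@[simp] theorem Config.shift_zero (s : Config L X) : s.shift 0 = s := by
  simp [Config.shift]

theorem Config.shift_sub (s : Config L X) {d e : ℝ≥0} (h : d ≤ e) :
    (s.shift d).shift (e - d) = s.shift e := by
  rw [Config.shift_shift, add_tsub_cancel_of_le h]

/-- Delays that take equivalent valuations across the same thresholds preserve equivalence. -/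
theorem DiagEq.shift {M : X → ℕ} {v w : Val X} (h : DiagEq M v w) {d d' : ℝ≥0}
    (hd : ∀ x, ∀ k : ℕ, (v x : ℝ) ≤ M x → k ≤ M x →
      (((k : ℝ) - v x ≤ d ↔ (k : ℝ) - w x ≤ d') ∧ ((d : ℝ) ≤ k - v x ↔ (d' : ℝ) ≤ k - w x))) :
    DiagEq M (v.shift d) (w.shift d') := by
  have hd0 := d.2
  have hd0' := d'.2
  refine ⟨fun x k hk => ?_, fun x k hk => ?_, fun x y hx hy m => ?_⟩
  · simp only [Val.coe_shift]
    by_cases hx : (v x : ℝ) ≤ M x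
    · have := (hd x k hx hk).2
      rw [le_sub_iff_add_le', le_sub_iff_add_le'] at this
      exact this
    · have hx' := mt (h.le x _ le_rfl).2 hx
      have hkM : (k : ℝ) ≤ M x := by exact_mod_cast hk
      rw [not_le] at hx hx'
      exact iff_of_false (by linarith) (by linarith)
  · simp only [Val.coe_shift]
    by_cases hx : (v x : ℝ) ≤ M x
    · have := (hd x k hx hk).1
      rw [sub_le_iff_le_add', sub_le_iff_le_add'] at this
      exact this
    · have hx' := mt (h.le x _ le_rfl).2 hx
      have hkM : (k : ℝ) ≤ M x := by exact_mod_cast hk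
      rw [not_le] at hx hx'
      exact iff_of_true (by linarith) (by linarith)
  · simp only [Val.coe_shift] at hx hy ⊢
    have := h.diff x y (by linarith) (by linarith) m
    rw [add_sub_add_right_eq_sub, add_sub_add_right_eq_sub]
    exact this

/-- If two finite families of reals are ordered alike, any position relative to the first can be
copied to the second: either a member of the family, or a point in the matching gap. -/
theorem exists_same_position {P : Type*} [Finite P] (a b : P → ℝ)
    (h : ∀ p q, a p ≤ a q ↔ b p ≤ b q) (d : ℝ) :
    ∃ d', ∀ p, (a p ≤ d ↔ b p ≤ d') ∧ (d ≤ a p ↔ d' ≤ b p) := by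
  classical
  have := Fintype.ofFinite P
  by_cases hd : ∃ p, a p = d
  · obtain ⟨p, rfl⟩ := hd
    exact ⟨b p, fun q => ⟨h q p, h p q⟩⟩
  · push Not at hd
    obtain ⟨m, hm, hm'⟩ := Order.exists_between_finsets
      ((Finset.univ.filter fun p => a p < d).image b)
      ((Finset.univ.filter fun p => d < a p).image b) (by
        simp only [Finset.mem_image, Finset.mem_filter, Finset.mem_univ, true_and]
        rintro _ ⟨p, hp, rfl⟩ _ ⟨q, hq, rfl⟩
        have := mt (h q p).2
        simp only [not_le] at this
        exact this (hp.trans hq))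
    simp only [Finset.mem_image, Finset.mem_filter, Finset.mem_univ, true_and,
      forall_exists_index, and_imp, forall_apply_eq_imp_iff₂] at hm hm'
    refine ⟨m, fun p => ?_⟩
    rcases lt_or_gt_of_ne (hd p) with hp | hp
    · exact ⟨iff_of_true hp.le (hm p hp).le, iff_of_false hp.not_ge (hm p hp).not_ge⟩
    · exact ⟨iff_of_false hp.not_ge (hm' p hp).not_ge, iff_of_true hp.le (hm' p hp).le⟩

/-- Region equivalence is a time-abstract bisimulation, also for the intermediate valuations. -/
theorem RegEq.exists_shift [Finite X] {M : X → ℕ} {v w : Val X} (h : RegEq M v w) (d : ℝ≥0) :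
    ∃ d' : ℝ≥0, RegEq M (v.shift d) (w.shift d') ∧
      ∀ e' ≤ d', ∃ e ≤ d, RegEq M (v.shift e) (w.shift e') := by
  have h := regEq_iff.1 h
  let Q := {x : X // (v x : ℝ) ≤ M x}
  -- The relevant instants are the delays `k - v x` at which a small clock reaches a constant. The
  -- extra point `none` stands for the instant 0 and keeps the copied delay nonnegative.
  let P := Option (Σ x : Q, Fin (M x + 1))
  let thr : Val X → P → ℝ := fun u p => p.elim 0 fun q => (q.2 : ℕ) - u q.1
  have hthr : ∀ p q, thr v p ≤ thr v q ↔ thr w p ≤ thr w q := by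
    rintro (_ | ⟨⟨x, hx⟩, k⟩) (_ | ⟨⟨y, hy⟩, l⟩)
    · simp [thr]
    · have := h.le y l (Nat.le_of_lt_succ l.2)
      simpa [thr] using this
    · have := h.ge x k (Nat.le_of_lt_succ k.2)
      simpa [thr] using this
    · have := h.diff y x hy hx ((l : ℤ) - k)
      push_cast at this
      simp only [thr, Option.elim]
      constructor <;> intro h'
      · have := this.1 (by linarith); linarith
      · have := this.2 (by linarith); linarith
  have conv : ∀ {e e' : ℝ≥0}, (∀ p, (thr v p ≤ e ↔ thr w p ≤ e') ∧ ((e : ℝ) ≤ thr v p ↔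
      (e' : ℝ) ≤ thr w p)) → RegEq M (v.shift e) (w.shift e') := by
    intro e e' he
    exact regEq_iff.2 (h.shift fun x k hx hk =>
      he (some ⟨⟨x, hx⟩, ⟨k, Nat.lt_succ_of_le hk⟩⟩))
  obtain ⟨d', hd'⟩ := exists_same_position (thr v) (thr w) hthr d
  have hd0 : 0 ≤ d' := by
    have := (hd' none).1
    simpa [thr] using this
  lift d' to ℝ≥0 using hd0
  refine ⟨d', conv hd', fun e' he' => ?_⟩
  -- For intermediate delays the endpoints `d'` and `d` join the two families, so that `e' ≤ d'`
  -- transfers to `e ≤ d`.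
  obtain ⟨e, he⟩ := exists_same_position
    (fun p : Option P => p.elim (d' : ℝ) (thr w)) (fun p => p.elim (d : ℝ) (thr v)) (by
      rintro (_ | p) (_ | q)
      · simp
      · exact (hd' q).2.symm
      · exact (hd' p).1.symm
      · exact (hthr p q).symm) e'
  have he0 : 0 ≤ e := by
    have := (he (some none)).1
    simpa [thr] using this
  lift e to ℝ≥0 using he0
  refine ⟨e, ?_, conv fun p => ⟨(he (some p)).1.symm, (he (some p)).2.symm⟩⟩
  have := (he none).2.1
  simp only [Option.elim, NNReal.coe_le_coe] at this
  exact this he'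

/-- Regions are convex in time: thresholds are passed monotonically, and clock differences do not
change during a delay. -/
theorem RegEq.of_le {M : X → ℕ} {v : Val X} {d e f : ℝ≥0}
    (h : RegEq M (v.shift d) (v.shift f)) (hde : d ≤ e) (hef : e ≤ f) :
    RegEq M (v.shift d) (v.shift e) := by
  have h := regEq_iff.1 h
  have hde : (d : ℝ) ≤ e := hde
  have hef : (e : ℝ) ≤ f := hef
  refine regEq_iff.2 ⟨fun x k hk => ?_, fun x k hk => ?_, fun x y hx hy m => ?_⟩
  · have := h.le x k hk
    simp only [Val.coe_shift] at this ⊢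
    constructor <;> intro h'
    · have := this.1 h'; linarith
    · linarith
  · have := h.ge x k hk
    simp only [Val.coe_shift] at this ⊢
    constructor <;> intro h'
    · linarith
    · exact this.2 (by linarith)
  · simp

/-- A difference with one clock reset is, up to sign, the value of the other clock, so its
comparison with `m` is a threshold condition, or is settled by the sign of `m` or the bound `M`. -/
theorem RegEq.reset {M : X → ℕ} {v w : Val X} (h : RegEq M v w) (R : Set X) :
    RegEq M (v.reset R) (w.reset R) := by
  have h := regEq_iff.1 h
  have key : ∀ y, (v y : ℝ) ≤ M y → ∀ m : ℤ, (-(v y : ℝ) ≤ m ↔ -(w y : ℝ) ≤ m) := by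
    intro y hy m
    have hy' := (h.le y _ le_rfl).1 hy
    have p := (v y).2
    have p' := (w y).2
    by_cases hm : 0 ≤ m
    · have : (0 : ℝ) ≤ m := by exact_mod_cast hm
      exact iff_of_true (by linarith) (by linarith)
    · obtain ⟨k, hk⟩ := Int.eq_ofNat_of_zero_le (a := -m) (by omega)
      have hm' : (m : ℝ) = -(k : ℝ) := by
        rw [← neg_neg m, hk]; simp
      rw [hm', neg_le_neg_iff, neg_le_neg_iff]
      by_cases hkM : k ≤ M y
      · exact h.ge y k hkM
      · have : (M y : ℝ) < k := by exact_mod_cast not_le.1 hkM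
        exact iff_of_false (by linarith) (by linarith)
  refine regEq_iff.2 ⟨fun x k hk => ?_, fun x k hk => ?_, fun x y hx hy m => ?_⟩
  · by_cases hx : x ∈ R <;> simp [Val.reset, hx, h.le x k hk]
  · by_cases hx : x ∈ R <;> simp [Val.reset, hx, h.ge x k hk]
  · by_cases hxR : x ∈ R <;> by_cases hyR : y ∈ R <;>
      simp only [Val.reset, hxR, hyR, if_true, if_false, NNReal.coe_zero, zero_sub, sub_zero]
        at hx hy ⊢
    · exact key y hy m
    · by_cases hm : (M x : ℤ) ≤ m
      · have hm' : (M x : ℝ) ≤ m := by exact_mod_cast hm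
        have := (h.le x _ le_rfl).1 hx
        exact iff_of_true (by linarith) (by linarith)
      · by_cases hm0 : 0 ≤ m
        · lift m to ℕ using hm0
          have := h.le x m (by omega)
          simpa using this
        · have : (m : ℝ) < 0 := by exact_mod_cast not_le.1 hm0
          have p := (v x).2
          have p' := (w x).2
          exact iff_of_false (by linarith) (by linarith)
    · exact h.diff x y hx hy m

theorem Guard.Sat.of_regEq {M : X → ℕ} {g : Guard X} (hg : g.BoundedBy M) {v w : Val X}
    (h : RegEq M v w) (hs : g.Sat v) : g.Sat w := by
  have h := regEq_iff.1 h
  intro a ha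
  have hs := hs a ha
  have h1 := h.le a.clock a.const (hg a ha)
  have h2 := h.ge a.clock a.const (hg a ha)
  have h1 : v a.clock ≤ a.const ↔ w a.clock ≤ a.const := by exact_mod_cast h1
  have h2 : (a.const : ℝ≥0) ≤ v a.clock ↔ (a.const : ℝ≥0) ≤ w a.clock := by exact_mod_cast h2
  revert hs
  cases a.cmp <;> simp only [Cmp.Holds, le_antisymm_iff, ge_iff_le, gt_iff_lt, ← not_le, h1, h2] <;>
    exact id

/-- Each atomic constraint cuts out an interval of values, and clocks grow monotonically. -/
theorem Guard.Sat.convex {g : Guard X} {v : Val X} {d e : ℝ≥0} (h : g.Sat v)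
    (h' : g.Sat (v.shift e)) (hd : d ≤ e) : g.Sat (v.shift d) := by
  intro a ha
  have h := h a ha
  have h' := h' a ha
  have p1 : v a.clock ≤ v.shift d a.clock := le_self_add
  have p2 : v.shift d a.clock ≤ v.shift e a.clock := add_le_add_right hd _
  revert h h'
  cases a.cmp <;> simp only [Cmp.Holds]
  · exact fun _ h => p2.trans_lt h
  · exact fun _ h => p2.trans h
  · exact fun h h' => le_antisymm (p2.trans h'.le) (h.ge.trans p1)
  · exact fun h _ => h.trans p1
  · exact fun h _ => h.trans_le p1

/-! ### The finite set of regions -/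

theorem mem_region_self (M : X → ℕ) (s : Config L X) : s ∈ region M s := ⟨rfl, .refl _⟩

theorem region_eq_of_mem {M : X → ℕ} {s t : Config L X} (h : t ∈ region M s) :
    region M t = region M s := by
  ext u
  exact ⟨fun hu => ⟨hu.1.trans h.1, h.2.trans hu.2⟩,
    fun hu => ⟨hu.1.trans h.1.symm, h.2.symm.trans hu.2⟩⟩

-- A region is determined by finite data: the location, the integer parts truncated at `M`, which
-- clocks are at most `M`, which fractional parts vanish, and their order.
open Classical in
theorem finite_regions [Finite X] [Finite L] (M : X → ℕ) :
    (Set.range fun s : Config L X => region M s).Finite := by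
  let data : Config L X → L × (∀ x, Fin (M x + 1)) × (X → Prop) × (X → Prop) × (X → X → Prop) :=
    fun s => (s.1, fun x => ⟨min ⌊s.2 x⌋₊ (M x), by omega⟩, fun x => s.2 x ≤ M x,
      fun x => frac (s.2 x) = 0, fun x y => frac (s.2 x) ≤ frac (s.2 y))
  have hfac : ∀ s t, data s = data t → region M s = region M t := by
    intro s t h
    simp only [data, Prod.mk.injEq] at h
    obtain ⟨h1, h2, h3, h4, h5⟩ := h
    refine (region_eq_of_mem ⟨h1.symm, ?_⟩).symm
    refine ⟨fun x => ?_, fun x _ => (congrFun h4 x).to_iff,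
      fun x y _ _ => (congrFun (congrFun h5 x) y).to_iff⟩
    have e3 := (congrFun h3 x).to_iff
    by_cases hx : s.2 x ≤ M x
    · have hy := e3.1 hx
      have e := congrArg Fin.val (congrFun h2 x)
      simp only at e
      have b1 : ⌊s.2 x⌋₊ ≤ M x := Nat.floor_le_of_le hx
      have b2 : ⌊t.2 x⌋₊ ≤ M x := Nat.floor_le_of_le hy
      rw [min_eq_left b1, min_eq_left b2] at e
      exact .inl ⟨e, e3⟩
    · exact .inr ⟨not_le.1 hx, not_le.1 (mt e3.2 hx)⟩
  have hfin : (Set.range data).Finite := Set.toFinite _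
  refine Set.Finite.subset (hfin.image fun y => if h : ∃ s, data s = y then region M h.choose else ∅)
    ?_
  rintro _ ⟨s, rfl⟩
  refine ⟨data s, ⟨s, rfl⟩, ?_⟩
  have h : ∃ s', data s' = data s := ⟨s, rfl⟩
  simp only [h, dif_pos]
  exact hfac _ _ h.choose_spec

/-- The number of thresholds that a valuation has reached or passed. -/
noncomputable def progress (M : X → ℕ) (v : Val X) : ℕ :=
  {p : Σ x, Fin (M x + 1) | ((p.2 : ℕ) : ℝ) ≤ v p.1}.ncard +
    {p : Σ x, Fin (M x + 1) | ¬ (v p.1 : ℝ) ≤ (p.2 : ℕ)}.ncard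

theorem progress_congr {M : X → ℕ} {v w : Val X} (h : RegEq M v w) :
    progress M v = progress M w := by
  have h := regEq_iff.1 h
  unfold progress
  congr 2
  · ext ⟨x, k⟩; exact h.ge x k (by omega)
  · ext ⟨x, k⟩; exact not_congr (h.le x k (by omega))

/-- The sets of thresholds reached and passed can only grow with time; if their sizes do not grow,
the sets are equal, and differences are unaffected by delays. Thus `progress` strictly increases
whenever time leaves a region. -/
theorem regEq_shift_of_progress_le [Finite X] {M : X → ℕ} {v : Val X} {d : ℝ≥0}
    (h : progress M (v.shift d) ≤ progress M v) : RegEq M v (v.shift d) := by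
  have hd := d.2
  unfold progress at h
  have s1 : {p : Σ x, Fin (M x + 1) | ((p.2 : ℕ) : ℝ) ≤ v p.1} ⊆
      {p : Σ x, Fin (M x + 1) | ((p.2 : ℕ) : ℝ) ≤ v.shift d p.1} := by
    rintro ⟨x, k⟩ hp
    simp only [Set.mem_ofPred_eq, Val.coe_shift] at hp ⊢
    linarith
  have s2 : {p : Σ x, Fin (M x + 1) | ¬ (v p.1 : ℝ) ≤ (p.2 : ℕ)} ⊆
      {p : Σ x, Fin (M x + 1) | ¬ (v.shift d p.1 : ℝ) ≤ (p.2 : ℕ)} := by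
    rintro ⟨x, k⟩ hp
    simp only [Set.mem_ofPred_eq, Val.coe_shift] at hp ⊢
    contrapose! hp
    linarith
  have c1 := Set.ncard_le_ncard s1 (Set.toFinite _)
  have c2 := Set.ncard_le_ncard s2 (Set.toFinite _)
  have e1 := Set.eq_of_subset_of_ncard_le s1 (by omega) (Set.toFinite _)
  have e2 := Set.eq_of_subset_of_ncard_le s2 (by omega) (Set.toFinite _)
  refine regEq_iff.2 ⟨fun x k hk => ?_, fun x k hk => ?_, fun x y _ _ m => by simp⟩
  · have := Set.ext_iff.1 e2 ⟨x, ⟨k, Nat.lt_succ_of_le hk⟩⟩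
    exact not_iff_not.1 this
  · exact Set.ext_iff.1 e1 ⟨x, ⟨k, Nat.lt_succ_of_le hk⟩⟩

/-! ### Unions of regions -/

/-- `V` is a union of regions. -/
def RegClosed (M : X → ℕ) (V : Set (Config L X)) : Prop :=
  ∀ s ∈ V, ∀ t ∈ region M s, t ∈ V

namespace RegClosed

variable {M : X → ℕ} {U V : Set (Config L X)}

theorem union (hU : RegClosed M U) (hV : RegClosed M V) : RegClosed M (U ∪ V) := by
  rintro s (hs | hs) t ht
  exacts [.inl (hU s hs t ht), .inr (hV s hs t ht)]

theorem compl (hV : RegClosed M V) : RegClosed M Vᶜ := fun s hs t ht ht' =>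
  hs (hV t ht' s (by rw [region_eq_of_mem ht]; exact mem_region_self M s))

theorem iUnion {ι : Type*} {V : ι → Set (Config L X)} (h : ∀ i, RegClosed M (V i)) :
    RegClosed M (⋃ i, V i) := by
  intro s hs t ht
  obtain ⟨i, hi⟩ := Set.mem_iUnion.1 hs
  exact Set.mem_iUnion.2 ⟨i, h i s hi t ht⟩

theorem empty : RegClosed M (∅ : Set (Config L X)) := fun _ hs => hs.elim

/-- The time-abstract bisimulation must also match intermediate delays, since `U` has to be avoided
all along. -/
theorem tPred [Finite X] (hV : RegClosed M V) (hU : RegClosed M U) :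
    RegClosed M (tPred V U) := by
  rintro s ⟨δ, hδ, hav⟩ t ⟨ht1, ht2⟩
  obtain ⟨δ', h1, h2⟩ := ht2.exists_shift δ
  refine ⟨δ', hV _ hδ _ ⟨ht1, h1⟩, fun e' he' hmem => ?_⟩
  obtain ⟨e, he, h3⟩ := h2 e' he'
  exact hav e he (hU _ hmem _ ⟨ht1.symm, h3.symm⟩)

variable {G : TGA I O L X}

theorem dPred (hG : ∀ e ∈ G.edges, e.guard.BoundedBy M) (B : Set (Act I O Empty))
    (hV : RegClosed M V) : RegClosed M (dPred G B V) := by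
  rintro s ⟨e, he, hB, hsrc, hg, hV'⟩ t ⟨ht1, ht2⟩
  exact ⟨e, he, hB, hsrc.trans ht1.symm, hg.of_regEq (hG e he) ht2, hV _ hV' _ ⟨rfl, ht2.reset _⟩⟩

variable {pass fail : Set (Config L X)}

theorem piOp [Finite X] (hG : ∀ e ∈ G.edges, e.guard.BoundedBy M) (hfail : RegClosed M fail)
    (hV : RegClosed M V) : RegClosed M (TimedTesting.piOp G fail V) :=
  ((hV.union (hV.dPred hG _)).tPred (hV.compl.dPred hG _)).union
    ((hfail.tPred (hV.compl.dPred hG _)).union ((hV.compl.dPred hG _).tPred empty).compl)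

theorem piOp_iterate [Finite X] (hG : ∀ e ∈ G.edges, e.guard.BoundedBy M)
    (hfail : RegClosed M fail) (hV : RegClosed M V) (i : ℕ) :
    RegClosed M ((TimedTesting.piOp G fail)^[i] V) := by
  induction i with
  | zero => exact hV
  | succ i ih => rw [Function.iterate_succ_apply']; exact RegClosed.piOp hG hfail ih

theorem W [Finite X] (hG : ∀ e ∈ G.edges, e.guard.BoundedBy M)
    (hpass : RegClosed M pass) (hfail : RegClosed M fail) (j i : ℕ) :
    RegClosed M (W G pass fail j i) := by
  refine piOp_iterate hG hfail ?_ i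
  induction j with
  | zero => exact hpass
  | succ j ih =>
    have := iUnion fun i => piOp_iterate hG hfail ih i
    exact (this.union (this.dPred hG _)).tPred empty

theorem WInf [Finite X] (hG : ∀ e ∈ G.edges, e.guard.BoundedBy M)
    (hpass : RegClosed M pass) (hfail : RegClosed M fail) (j : ℕ) :
    RegClosed M (WInf G pass fail j) := iUnion fun i => W hG hpass hfail j i

end RegClosed

end regions

/-! ## Traces and paths -/

namespace TimedTrace

variable {I O : Type*}

/-- Concatenation of traces. -/
def append (σ τ : TimedTrace I O) : TimedTrace I O :=
  (σ.1 ++ (addDelay σ.2 τ).1, (addDelay σ.2 τ).2)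

theorem addDelay_addDelay (d e : ℝ≥0) (σ : TimedTrace I O) :
    addDelay d (addDelay e σ) = addDelay (d + e) σ := by
  obtain ⟨_ | ⟨⟨_, _⟩, _⟩, _⟩ := σ <;> simp [addDelay, add_assoc]

theorem addDelay_zero (σ : TimedTrace I O) : addDelay 0 σ = σ := by
  obtain ⟨_ | ⟨⟨_, _⟩, _⟩, _⟩ := σ <;> simp [addDelay]

theorem addDelay_append (d : ℝ≥0) (σ τ : TimedTrace I O) :
    addDelay d (append σ τ) = append (addDelay d σ) τ := by
  obtain ⟨_ | ⟨⟨e, a⟩, w⟩, r⟩ := σ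
  · exact addDelay_addDelay d r τ
  · simp [append, addDelay]

theorem addDelay_injective (d : ℝ≥0) :
    Function.Injective (addDelay d : TimedTrace I O → TimedTrace I O) := by
  rintro ⟨_ | ⟨⟨e, a⟩, w⟩, r⟩ ⟨_ | ⟨⟨e', a'⟩, w'⟩, r'⟩ h <;> simp_all [addDelay]

end TimedTrace

section paths

variable {I O T L X : Type*}

theorem trace_append (μ ν : List (Label I O T L X)) :
    trace (μ ++ ν) = (trace μ).append (trace ν) := by
  induction μ with
  | nil => simp [trace, TimedTrace.append, TimedTrace.addDelay_zero]
  | cons γ μ ih =>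
    rcases γ with d | ⟨⟨_, _, a, _, _⟩, obs⟩
    · simp [trace, ih, TimedTrace.addDelay_append]
    · cases a <;> simp [trace, ih, TimedTrace.append]

namespace OTAIO

variable {A : OTAIO I O T L X}

theorem Step.left_mem {s s' : Config L X} {γ : Label I O T L X} (h : A.Step s γ s') :
    s ∈ A.configs := by
  cases γ <;> exact h.1

theorem Step.right_mem {s s' : Config L X} {γ : Label I O T L X} (h : A.Step s γ s') :
    s' ∈ A.configs := by
  cases γ <;> exact h.2.1

theorem Path.left_mem {s s' : Config L X} {μ : List (Label I O T L X)} (h : A.Path s μ s') :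
    s ∈ A.configs := by
  cases h with
  | nil _ h => exact h
  | cons h _ => exact h.left_mem

theorem Path.right_mem {s s' : Config L X} {μ : List (Label I O T L X)} (h : A.Path s μ s') :
    s' ∈ A.configs := by
  induction h with
  | nil _ h => exact h
  | cons _ _ ih => exact ih

theorem Path.append {s t u : Config L X} {μ ν : List (Label I O T L X)} (h : A.Path s μ t)
    (h' : A.Path t ν u) : A.Path s (μ ++ ν) u := by
  induction h with
  | nil => exact h'
  | cons h _ ih => exact .cons h (ih h')

theorem Path.single {s t : Config L X} {γ : Label I O T L X} (h : A.Step s γ t) :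
    A.Path s [γ] t := .cons h (.nil _ h.right_mem)

theorem initConfig_mem : A.initConfig ∈ A.configs := A.init_inv

theorem Reach.step {s t : Config L X} {γ : Label I O T L X} (hs : s ∈ A.Reach)
    (h : A.Step s γ t) : t ∈ A.Reach := by
  obtain ⟨μ, hμ⟩ := hs
  exact ⟨_, hμ.append (.single h)⟩

theorem Reach.init : A.initConfig ∈ A.Reach := ⟨[], .nil _ initConfig_mem⟩

/-- A path of an automaton without internal actions can be cut wherever its trace can. -/
theorem Path.split {D : OTAIO I O Empty L X} {s u : Config L X}
    {μ : List (Label I O Empty L X)} (h : D.Path s μ u) :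
    ∀ σ τ : TimedTrace I O, trace μ = σ.append τ →
      ∃ μ₁ μ₂ t, D.Path s μ₁ t ∧ D.Path t μ₂ u ∧ trace μ₁ = σ := by
  induction h with
  | nil s hs =>
    rintro ⟨w, r⟩ ⟨w', r'⟩ h
    refine ⟨[], [], s, .nil _ hs, .nil _ hs, ?_⟩
    rcases w with _ | ⟨p, w⟩
    · rcases w' with _ | ⟨p', w'⟩
      · simp only [trace, TimedTrace.append, TimedTrace.addDelay, List.append_nil,
          Prod.mk.injEq, true_and] at h
        have : r = 0 := (add_eq_zero.1 h.symm).1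
        rw [this]; rfl
      · simp [trace, TimedTrace.append, TimedTrace.addDelay] at h
    · simp [trace, TimedTrace.append] at h
  | @cons s s' u γ μ hst hp ih =>
    intro σ τ h
    rcases γ with d | ⟨e, obs⟩
    · -- a delay
      -- Either the cut comes after the whole delay `d`, or it falls inside this delay.
      by_cases hd : ∃ σ', σ = TimedTrace.addDelay d σ'
      · obtain ⟨σ', rfl⟩ := hd
        rw [trace, ← TimedTrace.addDelay_append] at h
        obtain ⟨μ₁, μ₂, t, h1, h2, h3⟩ := ih σ' τ (TimedTrace.addDelay_injective d h)
        exact ⟨_, μ₂, t, .cons hst h1, h2, by rw [trace, h3]⟩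
      · obtain ⟨_ | ⟨⟨c, a⟩, w⟩, r⟩ := σ
        · have hr : r ≤ d := by
            by_contra hr
            exact hd ⟨([], r - d), by simp [TimedTrace.addDelay, add_tsub_cancel_of_le
              (not_le.1 hr).le]⟩
          obtain ⟨hs, hs', rfl⟩ := hst
          -- Stopping midway is allowed because invariants are convex.
          have hm : s.shift r ∈ D.configs := Guard.Sat.convex hs hs' hr
          refine ⟨[.delay r], .delay (d - r) :: μ, s.shift r, .single ⟨hs, hm, rfl⟩,
            .cons ⟨hm, hs', (Config.shift_sub s hr).symm⟩ hp, ?_⟩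
          simp [trace, TimedTrace.addDelay]
        -- A cut after some action cannot fall inside the delay: the first action of `σ` is preceded
        -- by at least `d`.
        · exfalso
          have hc : d ≤ c := by
            rcases hμ : trace μ with ⟨_ | ⟨⟨c', a'⟩, w'⟩, r'⟩
            · simp [trace, hμ, TimedTrace.addDelay, TimedTrace.append] at h
            · simp only [trace, hμ, TimedTrace.addDelay, TimedTrace.append, List.cons_append,
                Prod.mk.injEq, List.cons.injEq] at h
              rw [← h.1.1.1]
              exact le_self_add
          exact hd ⟨((c - d, a) :: w, r), by simp [TimedTrace.addDelay, add_tsub_cancel_of_le hc]⟩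
    · obtain ⟨a, ha⟩ : ∃ a, trace (.edge e obs :: μ) = ((0, a) :: (trace μ).1, (trace μ).2) ∧
          ∀ ν : List (Label I O Empty L X),
            trace (.edge e obs :: ν) = ((0, a) :: (trace ν).1, (trace ν).2) := by
        obtain ⟨e1, e2, a, e3, e4⟩ := e
        cases a with
        | inp a => exact ⟨.inl a, rfl, fun _ => rfl⟩
        | out a => exact ⟨.inr a, rfl, fun _ => rfl⟩
        | tau a => exact a.elim
      rw [ha.1] at h
      obtain ⟨_ | ⟨⟨c, a'⟩, w⟩, r⟩ := σ
      · refine ⟨[], .edge e obs :: μ, s, .nil _ hst.left_mem, .cons hst hp, ?_⟩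
        obtain ⟨_ | ⟨⟨c', a'⟩, w'⟩, r'⟩ := τ
        · simp [TimedTrace.append, TimedTrace.addDelay] at h
        · simp only [TimedTrace.append, TimedTrace.addDelay, List.nil_append,
            Prod.mk.injEq, List.cons.injEq] at h
          have : r = 0 := (add_eq_zero.1 h.1.1.1.symm).1
          rw [this]; rfl
      · have h' : trace μ = TimedTrace.append (w, r) τ := by
          simp only [TimedTrace.append, List.cons_append, Prod.mk.injEq, List.cons.injEq] at h ⊢
          exact Prod.ext h.1.2 h.2
        obtain ⟨μ₁, μ₂, t, h1, h2, h3⟩ := ih _ τ h'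
        refine ⟨_, μ₂, t, .cons hst h1, h2, ?_⟩
        rw [ha.2, h3]
        simp only [TimedTrace.append, List.cons_append, Prod.mk.injEq, List.cons.injEq] at h
        rw [h.1.1.1, h.1.1.2]

/-- A path between two locations takes some transition after a first delay. -/
theorem Path.exists_edge {s u : Config L X} {μ : List (Label I O T L X)} (h : A.Path s μ u)
    (hne : s.1 ≠ u.1) : ∃ d e obs t, A.Step (s.shift d) (.edge e obs) t := by
  induction h with
  | nil => exact absurd rfl hne
  | @cons s s' u γ μ hst _ ih =>
    rcases γ with d | ⟨e, obs⟩
    · obtain ⟨-, -, rfl⟩ := hst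
      obtain ⟨d', e, obs, t, h⟩ := ih hne
      exact ⟨d + d', e, obs, t, by rwa [Config.shift_shift] at h⟩
    · exact ⟨0, e, obs, s', by rwa [Config.shift_zero]⟩

end OTAIO

end paths

/-! ## The product of a specification and a test purpose -/

section artifacts

variable {In Out Tau LS XS LT XT LD XD : Type*}

theorem Guard.sat_rename {X Y : Type*} {i : X → Y} {g : Guard X} {v : Val Y} :
    (g.rename i).Sat v ↔ g.Sat (v ∘ i) := by
  simp [Guard.Sat, Guard.rename]

theorem Guard.sat_append {X : Type*} {g h : Guard X} {v : Val X} :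
    Guard.Sat (g ++ h) v ↔ g.Sat v ∧ h.Sat v := by
  simp only [Guard.Sat, List.mem_append]
  exact ⟨fun H => ⟨fun a ha => H a (.inl ha), fun a ha => H a (.inr ha)⟩,
    fun H a ha => ha.elim (H.1 a) (H.2 a)⟩

variable {S : OTAIO (Option In) Out Tau LS XS} {P : OTAIO (Option In) Out Tau LT (XT ⊕ XS)}

theorem reset_comp_inr {R : Set XS} {R' : Set (XT ⊕ XS)} (h : R' ⊆ Set.range Sum.inl)
    (v : Val (XT ⊕ XS)) :
    v.reset (Sum.inr '' R ∪ R') ∘ Sum.inr = Val.reset (v ∘ Sum.inr) R := by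
  funext x
  have hx : (Sum.inr x : XT ⊕ XS) ∈ Sum.inr '' R ∪ R' ↔ x ∈ R := by
    refine ⟨?_, fun h => .inl ⟨x, h, rfl⟩⟩
    rintro (⟨y, hy, h'⟩ | h')
    · exact Sum.inr.inj h' ▸ hy
    · obtain ⟨y, hy⟩ := h h'
      cases hy
  by_cases hR : x ∈ R
  · simp only [Function.comp_apply, Val.reset, if_pos (hx.2 hR), if_pos hR]
  · simp only [Function.comp_apply, Val.reset, if_neg (mt hx.1 hR), if_neg hR]

/-- The test purpose never resets the clocks it observes, so they evolve as in the specification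
alone. This makes `restart_reachable` applicable to reachable configurations of the product. -/
theorem product_step_proj {s s' : Config (LS × LT) (XT ⊕ XS)}
    (hP : P.proper = Set.range Sum.inl) {γ : Label (Option In) Out Tau (LS × LT) (XT ⊕ XS)}
    (h : (product S P).Step s γ s') :
    ∃ γ', S.Step (s.1.1, s.2 ∘ Sum.inr) γ' (s'.1.1, s'.2 ∘ Sum.inr) := by
  have hs : (S.inv s.1.1).Sat (s.2 ∘ Sum.inr) :=
    Guard.sat_rename.1 (Guard.sat_append.1 h.left_mem).1
  have hs' : (S.inv s'.1.1).Sat (s'.2 ∘ Sum.inr) :=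
    Guard.sat_rename.1 (Guard.sat_append.1 h.right_mem).1
  rcases γ with d | ⟨e, obs⟩
  · obtain ⟨-, -, rfl⟩ := h
    exact ⟨.delay d, hs, hs', rfl⟩
  · obtain ⟨-, -, ⟨⟨e₁, e₂⟩, ⟨he₁, he₂, -⟩, rfl⟩, hobs, hsrc, hg, rfl⟩ := h
    refine ⟨.edge e₁ ∅, hs, hs', he₁, Set.empty_subset _, congrArg Prod.fst hsrc,
      (Guard.sat_rename (i := Sum.inr) (v := s.2)).1 (Guard.sat_append.1 hg).1, Prod.ext rfl ?_⟩
    have hobs' : obs = ∅ := Set.eq_empty_of_subset_empty (by simpa [product] using hobs)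
    have hr := P.reset_proper _ he₂
    rw [hP] at hr
    rw [hobs', Set.union_empty, Set.union_empty]
    exact reset_comp_inr hr s.2

theorem product_reach_proj (hP : P.proper = Set.range Sum.inl)
    {s s' : Config (LS × LT) (XT ⊕ XS)} {μ : List (Label (Option In) Out Tau (LS × LT) (XT ⊕ XS))}
    (h : (product S P).Path s μ s') (hs : (s.1.1, s.2 ∘ Sum.inr) ∈ S.Reach) :
    (s'.1.1, s'.2 ∘ Sum.inr) ∈ S.Reach := by
  induction h with
  | nil => exact hs
  | cons h _ ih =>
    obtain ⟨γ', h'⟩ := product_step_proj hP h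
    exact ih (OTAIO.Reach.step hs h')

theorem mem_product_configs (hP : P.Complete) {s : Config (LS × LT) (XT ⊕ XS)}
    (h : (s.1.1, s.2 ∘ Sum.inr) ∈ S.configs) : s ∈ (product S P).configs :=
  Guard.sat_append.2 ⟨Guard.sat_rename.2 h, hP.1 (s.1.2, s.2)⟩

/-- Completeness of the test purpose supplies a partner with the same action for any transition of
the specification; its trivial invariants cannot block the step. -/
theorem product_edge_lift (hS : S.AllProper) (hP : IsTestPurpose P) {l : LS} {k : LT}
    {v : Val (XT ⊕ XS)} {e : Edge (Option In) Out Tau LS XS} {obs : Set XS} {s' : Config LS XS}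
    (h : S.Step (l, v ∘ Sum.inr) (.edge e obs) s') :
    ∃ e' ∈ P.edges, e'.act = e.act ∧
      (product S P).Step ((l, k), v) (.edge (syncEdge (e, e')) ∅)
        ((s'.1, e'.tgt), v.reset (Sum.inr '' e.reset ∪ e'.reset)) ∧
      v.reset (Sum.inr '' e.reset ∪ e'.reset) ∘ Sum.inr = s'.2 ∧ e.tgt = s'.1 := by
  obtain ⟨e', obs', t, hact, ht⟩ := hP.complete.2 (k, v) e.act
  obtain ⟨-, -, he', -, hsrc', hg', -⟩ := ht
  obtain ⟨hl, hr, he, hobs, hsrc, hg, rfl⟩ := h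
  have hobs' : obs = ∅ := Set.eq_empty_of_subset_empty (by
    rw [OTAIO.AllProper] at hS; simpa [hS] using hobs)
  have hr' := P.reset_proper _ he'
  rw [hP.proper] at hr'
  have hv : v.reset (Sum.inr '' e.reset ∪ e'.reset) ∘ Sum.inr =
      Val.reset (v ∘ Sum.inr) (e.reset ∪ obs) := by
    rw [hobs', Set.union_empty]
    exact reset_comp_inr hr' v
  refine ⟨e', he', hact, ⟨mem_product_configs hP.complete hl, mem_product_configs hP.complete ?_,
    ⟨(e, e'), ⟨he, he', hact.symm⟩, rfl⟩, Set.empty_subset _, Prod.ext hsrc hsrc', ?_, ?_⟩, hv, rfl⟩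
  · simpa only [hv] using hr
  · exact Guard.sat_append.2 ⟨Guard.sat_rename.2 hg, hg'⟩
  · simp [syncEdge]

theorem product_path_lift (hS : S.AllProper) (hP : IsTestPurpose P) {s s' : Config LS XS}
    {μ : List (Label (Option In) Out Tau LS XS)} (h : S.Path s μ s') :
    ∀ (k : LT) (v : Val (XT ⊕ XS)), v ∘ Sum.inr = s.2 → ∃ ν k' v',
      (product S P).Path ((s.1, k), v) ν ((s'.1, k'), v') ∧ v' ∘ Sum.inr = s'.2 := by
  induction h with
  | nil s hs =>
    intro k v hv
    exact ⟨[], k, v, .nil _ (mem_product_configs hP.complete (by rw [hv]; exact hs)), hv⟩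
  | @cons s s' s'' γ μ hst _ ih =>
    intro k v hv
    rcases γ with d | ⟨e, obs⟩
    · obtain ⟨hs, hs', rfl⟩ := hst
      have hv' : v.shift d ∘ Sum.inr = (s.shift d).2 := by
        rw [Config.shift, ← hv]; rfl
      obtain ⟨ν, k', v', hp, h'⟩ := ih k (v.shift d) hv'
      refine ⟨.delay d :: ν, k', v', .cons ⟨mem_product_configs hP.complete ?_, hp.left_mem, rfl⟩
        hp, h'⟩
      rw [hv]; exact hs
    · have hst' : S.Step (s.1, v ∘ Sum.inr) (.edge e obs) s' := by rw [hv]; exact hst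
      obtain ⟨e', -, -, h1, h2, -⟩ := product_edge_lift (k := k) hS hP hst'
      obtain ⟨ν, k', v', hp, h'⟩ := ih _ _ h2
      exact ⟨_, k', v', .cons h1 hp, h'⟩

/-- The product can return to its initial configuration. -/
theorem product_restart (hS : IsSpecification S) (hP : IsTestPurpose P)
    {s : Config (LS × LT) (XT ⊕ XS)} (hs : s ∈ (product S P).Reach) :
    ∃ ν, (product S P).Path s ν (product S P).initConfig := by
  obtain ⟨μ, hμ⟩ := hs
  have hr := product_reach_proj hP.proper hμ
    (by exact OTAIO.Reach.init (A := S))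
  obtain ⟨μ', s', e, obs, hp, hact, hst⟩ := hS.restart_reachable _ hr
  obtain ⟨ν, k', v', hν, hv'⟩ := product_path_lift hS.proper_eq_univ hP hp s.1.2 s.2 rfl
  have hst' : S.Step (s'.1, v' ∘ Sum.inr) (.edge e obs) S.initConfig := by rw [hv']; exact hst
  obtain ⟨e', he', hact', h1, -, -⟩ := product_edge_lift (k := k') hS.proper_eq_univ hP hst'
  obtain ⟨hreset, htgt⟩ := hS.restart e hst.2.2.1 hact
  obtain ⟨hreset', htgt'⟩ := hP.restart e' he' (hact'.trans hact)
  -- Between them, the two ζ-transitions reset every clock: the specification its own, the test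
  -- purpose its proper ones.
  have heq : (((S.initConfig.1, e'.tgt), v'.reset (Sum.inr '' e.reset ∪ e'.reset)) :
      Config (LS × LT) (XT ⊕ XS)) = (product S P).initConfig := by
    have hSp : S.proper = Set.univ := hS.proper_eq_univ
    refine Prod.ext (Prod.ext rfl htgt') ?_
    funext x
    rw [hreset, hreset', hP.proper, hSp]
    rcases x with x | x <;> simp [Val.reset, product, OTAIO.initConfig]
  rw [heq] at h1
  exact ⟨_, hν.append (.single h1)⟩

variable {AccP : Set LT} {D : OTAIO (Option In) Out Empty LD XD} {AccD : Set LD}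

/-- From every reachable configuration of the determinization, an accepting location can be
reached, if one can be reached at all. -/
theorem exists_path_accepting (hS : IsSpecification S) (hP : IsTestPurpose P)
    (hD : IsExactDeterminization (product S P) {l | l.2 ∈ AccP} D AccD)
    (hacc : ∃ s ∈ D.Reach, s.1 ∈ AccD) {t : Config LD XD} (ht : t ∈ D.Reach) :
    ∃ μ u, D.Path t μ u ∧ u.1 ∈ AccD := by
  obtain ⟨s₀, ⟨μ₀, hμ₀⟩, hs₀⟩ := hacc
  have hA : trace μ₀ ∈ (product S P).AcceptedTraces {l | l.2 ∈ AccP} := by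
    rw [← hD.accepted]; exact ⟨s₀, ⟨μ₀, hμ₀, rfl⟩, hs₀⟩
  obtain ⟨a, ⟨ν₀, hν₀, -⟩, ha⟩ := hA
  obtain ⟨μ, hμ⟩ := ht
  have hT : trace μ ∈ D.Traces := ⟨t, μ, hμ, rfl⟩
  obtain ⟨t', ht'⟩ := hD.deterministic _ hT
  have htt : t = t' := by
    have : t ∈ D.after (trace μ) := ⟨μ, hμ, rfl⟩
    rw [ht'] at this; exact this
  rw [hD.traces] at hT
  obtain ⟨s, ν, hν, hνt⟩ := hT
  -- The product replays the trace of `t`, restarts, and then follows a run to an accepting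
  -- location.
  obtain ⟨ν', hν'⟩ := product_restart hS hP ⟨ν, hν⟩
  have hacc : trace (ν ++ (ν' ++ ν₀)) ∈ D.AcceptedTraces AccD := by
    rw [hD.accepted]; exact ⟨a, ⟨_, hν.append (hν'.append hν₀), rfl⟩, ha⟩
  obtain ⟨u, ⟨κ, hκ, hκt⟩, hu⟩ := hacc
  rw [trace_append, hνt] at hκt
  -- The accepted path of `D` is cut after the trace of `t`; by determinism the cut point is `t`
  -- itself, so the remainder starts there.
  obtain ⟨κ₁, κ₂, t'', h1, h2, h3⟩ := hκ.split _ _ hκt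
  have htt' : t'' = t' := by
    have : t'' ∈ D.after (trace μ) := ⟨κ₁, h1, h3⟩
    rw [ht'] at this; exact this
  subst htt'; subst htt
  exact ⟨κ₂, u, h2, hu⟩

end artifacts

/-! ## The hierarchy -/

section hierarchy

variable {I O L X : Type*}
variable {G : TGA I O L X} {pass fail : Set (Config L X)}

theorem tPred_of_mem {V : Set (Config L X)} {s : Config L X} (δ : ℝ≥0)
    (h : s.shift δ ∈ V) : s ∈ tPred V ∅ := ⟨δ, h, fun _ _ h => h⟩

theorem WBase_succ (j : ℕ) : W G pass fail (j + 1) 0 =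
    tPred (WInf G pass fail j ∪ dPred G Set.univ (WInf G pass fail j)) ∅ := rfl

/-- Together with the delay 0 in `W^{j+1}_0`, this makes the sets `W^j_∞` increase with `j`. -/
theorem W_subset_WInf (j i : ℕ) : W G pass fail j i ⊆ WInf G pass fail j :=
  Set.subset_iUnion (fun i => W G pass fail j i) i

theorem WInf_mono : Monotone (WInf G pass fail) := by
  refine monotone_nat_of_le_succ fun j s hs => W_subset_WInf (j + 1) 0 ?_
  rw [WBase_succ]
  exact tPred_of_mem 0 (.inl (by simpa using hs))

theorem W_succ (j i : ℕ) : W G pass fail j (i + 1) = piOp G fail (W G pass fail j i) :=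
  Function.iterate_succ_apply' _ _ _

end hierarchy

/-! ## The tester and the determinization -/

section tester

variable {I O L X : Type*} {D : OTAIO I O Empty L X} {AccD : Set L}

theorem exists_loc_of_not_mem_failSet {s : Config (Option L) X} (h : s ∉ failSet D) :
    ∃ l, s.1 = some l ∧ (l, s.2) ∈ D.configs := by
  obtain ⟨_ | l, v⟩ := s
  · exact absurd (.inl rfl) h
  · refine ⟨l, rfl, ?_⟩
    by_contra h'
    exact h (.inr ⟨l, rfl, h'⟩)

theorem not_mem_failSet_of_le {s : Config (Option L) X} (h : s ∉ failSet D) {d e : ℝ≥0}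
    (he : s.shift e ∉ failSet D) (hd : d ≤ e) : s.shift d ∉ failSet D := by
  obtain ⟨l, hl, hs⟩ := exists_loc_of_not_mem_failSet h
  obtain ⟨l', hl', hs'⟩ := exists_loc_of_not_mem_failSet he
  obtain rfl : l = l' := Option.some.inj (hl.symm.trans hl')
  have := Guard.Sat.convex hs hs' hd
  rintro (h0 | ⟨l'', h0, h1⟩)
  · exact absurd (h0.symm.trans hl) (by simp)
  · obtain rfl : l = l'' := Option.some.inj (hl.symm.trans h0)
    exact h1 this

theorem mem_passSet_of_mem_accepting {s : Config (Option L) X} {l : L} (hl : s.1 = some l)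
    (hacc : l ∈ AccD) (h : s ∉ failSet D) : s ∈ passSet D AccD := by
  obtain ⟨l', hl', hs⟩ := exists_loc_of_not_mem_failSet h
  obtain rfl : l = l' := Option.some.inj (hl.symm.trans hl')
  exact ⟨l, hacc, hl, hs⟩

theorem regClosed_failSet {M : X → ℕ} (hM : ∀ l, (D.inv l).BoundedBy M) :
    RegClosed M (failSet D) := by
  rintro s hs t ⟨ht1, ht2⟩
  rcases hs with hs | ⟨l, hl, hs⟩
  · exact .inl (ht1.trans hs)
  · exact .inr ⟨l, ht1.trans hl, fun h => hs (h.of_regEq (hM l) ht2.symm)⟩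

theorem regClosed_passSet {M : X → ℕ} (hM : ∀ l, (D.inv l).BoundedBy M) :
    RegClosed M (passSet D AccD) := by
  rintro s ⟨l, hacc, hl, hs⟩ t ⟨ht1, ht2⟩
  exact ⟨l, hacc, ht1.trans hl, hs.of_regEq (hM l) ht2⟩

variable [Finite I] [Finite O] [Finite L] {C : OutputComplement D}

theorem mem_configs_tester (s : Config (Option L) X) : s ∈ (tester D C).configs :=
  fun _ ha => absurd ha List.not_mem_nil

theorem obs_eq_empty_of_step (hD : D.AllProper) {s s' : Config (Option L) X}
    {e : Edge I O Empty (Option L) X} {obs : Set X}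
    (h : (tester D C).Step s (.edge e obs) s') : obs = ∅ := by
  have hobs := h.2.2.2.1
  have hp : (tester D C).proper = Set.univ := hD
  rw [hp] at hobs
  exact Set.eq_empty_of_subset_empty (by simpa using hobs)

/-- The configuration is reachable in the determinization. -/
def ReachableIn (D : OTAIO I O Empty L X) (s : Config (Option L) X) : Prop :=
  ∃ l, s.1 = some l ∧ (l, s.2) ∈ D.Reach

/-- The transitions added to `D` all lead to the location Fail, and outside Fail the invariants of
`D` hold; what remains is a genuine step of `D`. -/
theorem ReachableIn.step (hD : D.AllProper) {s s' : Config (Option L) X}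
    {γ : Label I O Empty (Option L) X} (hs : ReachableIn D s)
    (h : (tester D C).Step s γ s') (hs' : s' ∉ failSet D) : ReachableIn D s' := by
  obtain ⟨l', hl', hc'⟩ := exists_loc_of_not_mem_failSet hs'
  obtain ⟨l, hl, hr⟩ := hs
  refine ⟨l', hl', ?_⟩
  have hc : (l, s.2) ∈ D.configs := hr.elim fun _ h => h.right_mem
  rcases γ with d | ⟨e, obs⟩
  · obtain ⟨-, -, rfl⟩ := h
    obtain rfl : l = l' := Option.some.inj (hl.symm.trans hl')
    exact OTAIO.Reach.step hr (γ := .delay d) ⟨hc, hc', rfl⟩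
  · obtain rfl := obs_eq_empty_of_step hD h
    obtain ⟨-, -, he, -, hsrc, hg, rfl⟩ := h
    rcases he with (⟨e', he', rfl⟩ | he) | ⟨a, rfl⟩
    · refine OTAIO.Reach.step hr (γ := .edge e' ∅) ⟨hc, hc', he', Set.empty_subset _,
        Option.some.inj (hsrc.trans hl), hg, Prod.ext (Option.some.inj hl').symm rfl⟩
    · obtain ⟨p, g, -, rfl⟩ := Set.mem_iUnion.1 he
      simp at hl'
    · simp at hl'

theorem exists_reach_accepting (hD : D.AllProper)
    (hpass : ∃ s ∈ passSet D AccD, ReachAvoiding (tester D C) (failSet D) s) :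
    ∃ s ∈ D.Reach, s.1 ∈ AccD := by
  obtain ⟨s, ⟨l, hacc, hl, -⟩, hs⟩ := hpass
  have : ReachableIn D s := by
    clear hl
    induction hs with
    | init => exact ⟨D.init, rfl, OTAIO.Reach.init⟩
    | step _ h h' ih => exact ih.step hD h h'
  obtain ⟨l', hl', hr⟩ := this
  obtain rfl : l = l' := Option.some.inj (hl.symm.trans hl')
  exact ⟨_, hr, hacc⟩

theorem mem_dPred_of_edge {l : L} {v : Val X} {s' : Config L X} {e : Edge I O Empty L X}
    {obs : Set X} (hD : D.AllProper) (h : D.Step (l, v) (.edge e obs) s')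
    {V : Set (Config (Option L) X)} (hV : (some s'.1, s'.2) ∈ V) :
    (some l, v) ∈ dPred (tester D C) Set.univ V := by
  have hobs : obs = ∅ := Set.eq_empty_of_subset_empty (by
    have := h.2.2.2.1
    rw [OTAIO.AllProper] at hD; simpa [hD] using this)
  subst hobs
  obtain ⟨-, -, he, -, hsrc, hg, rfl⟩ := h
  refine ⟨liftEdge e, .inl (.inl ⟨e, he, rfl⟩), trivial, congrArg some hsrc, hg, ?_⟩
  simpa [liftEdge] using hV

/-- The endpoint is in Pass, and going backwards a delay or a transition into `W^j_∞` puts its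
source in `W^{j+1}_0`. -/
theorem mem_WInf_of_path (hD : D.AllProper) {s u : Config L X}
    {μ : List (Label I O Empty L X)} (h : D.Path s μ u) (hu : u.1 ∈ AccD) :
    ∃ j, (some s.1, s.2) ∈ WInf (tester D C) (passSet D AccD) (failSet D) j := by
  induction h with
  | nil s hs => exact ⟨0, W_subset_WInf 0 0 ⟨s.1, hu, rfl, hs⟩⟩
  | @cons s s' u γ μ hst _ ih =>
    obtain ⟨j, hj⟩ := ih hu
    refine ⟨j + 1, W_subset_WInf (j + 1) 0 ?_⟩
    rw [WBase_succ]
    rcases γ with d | ⟨e, obs⟩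
    · obtain ⟨-, -, rfl⟩ := hst
      exact tPred_of_mem d (.inl hj)
    · exact tPred_of_mem 0 (.inr (by
        rw [Config.shift_zero]; exact mem_dPred_of_edge hD hst hj))

end tester

/-! ## Runs and outcomes -/

section outcomes

variable {I O L X : Type*} {G : TGA I O L X}

theorem FinRun.last_snoc (σ : FinRun I O L X) (γ : Label I O Empty L X) (s : Config L X) :
    (σ.snoc γ s).last = s := by
  simp [FinRun.last, FinRun.snoc, List.getLastD_eq_getLast?]

theorem FinRun.snoc_inj {σ σ' : FinRun I O L X} {γ γ' : Label I O Empty L X} {s s' : Config L X}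
    (h : σ.snoc γ s = σ'.snoc γ' s') : σ = σ' ∧ γ = γ' ∧ s = s' := by
  obtain ⟨a, l⟩ := σ
  obtain ⟨a', l'⟩ := σ'
  obtain rfl : a = a' := congrArg FinRun.first h
  have hl : l ++ [(γ, s)] = l' ++ [(γ', s')] := congrArg FinRun.steps h
  obtain ⟨rfl, hs⟩ := List.append_inj' hl rfl
  cases hs
  exact ⟨rfl, rfl, rfl⟩

theorem FinRun.validFrom_concat {s : Config L X} {l : List (Label I O Empty L X × Config L X)}
    {γ : Label I O Empty L X} {s' : Config L X} (h : FinRun.ValidFrom G s l)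
    (h' : G.Step ((l.map Prod.snd).getLastD s) γ s') : FinRun.ValidFrom G s (l ++ [(γ, s')]) := by
  induction l generalizing s with
  | nil => exact ⟨h', trivial⟩
  | cons p l ih =>
    obtain ⟨γ', t⟩ := p
    refine ⟨h.1, ih h.2 ?_⟩
    simpa only [List.map_cons, List.getLastD_cons] using h'

namespace InfRun

variable (ρ : InfRun G)

theorem take_succ (n : ℕ) : ρ.take (n + 1) = (ρ.take n).snoc (ρ.label n) (ρ.state (n + 1)) := by
  simp [take, FinRun.snoc, List.range_succ]

theorem last_take (n : ℕ) : (ρ.take n).last = ρ.state n := by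
  cases n with
  | zero => rfl
  | succ n => rw [take_succ, FinRun.last_snoc]

theorem isRun_take (n : ℕ) : (ρ.take n).IsRun G := by
  refine ⟨ρ.state_zero, ?_⟩
  induction n with
  | zero => trivial
  | succ n ih =>
    rw [take_succ]
    refine FinRun.validFrom_concat ih ?_
    change G.Step (ρ.take n).last _ _
    rw [last_take]
    exact ρ.step n

theorem length_take (n : ℕ) : (ρ.take n).steps.length = n := by simp [take]

variable {ρ}

theorem state_succ_of_delay {n : ℕ} {γ : ℝ≥0} (h : ρ.label n = .delay γ) :
    ρ.state (n + 1) = (ρ.state n).shift γ := by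
  have := ρ.step n
  rw [h] at this
  exact this.2.2

end InfRun

/-- At its `n`-th step, the run waits for the whole delay that the strategy proposes. -/
def WaitsAt (f : Strat I O L X) (ρ : InfRun G) (n : ℕ) : Prop :=
  ∃ δ, f (ρ.take n) = some (δ, none) ∧ ρ.label n = .delay δ

/-- From its `n`-th step on, the run performs a delay and a transition that comply with the
strategy. -/
def ActsAt (f : Strat I O L X) (ρ : InfRun G) (n : ℕ) : Prop :=
  ∃ δ a γ e, f (ρ.take n) = some (δ, a) ∧ ρ.label n = .delay γ ∧ ρ.label (n + 1) = .edge e ∅ ∧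
    ((γ ≤ δ ∧ ∃ b, e.act = .out b) ∨ (γ = δ ∧ ∃ c, a = some c ∧ e.act = .inp c))

variable {f : Strat I O L X} {ρ : InfRun G}

theorem Outcome.cases_take {s : Config L X} {m : ℕ} (h : Outcome G f s (ρ.take m)) :
    m = 0 ∨ (∃ n, m = n + 1 ∧ Outcome G f s (ρ.take n) ∧ WaitsAt f ρ n) ∨
      ∃ n, m = n + 2 ∧ Outcome G f s (ρ.take n) ∧ ActsAt f ρ n := by
  have hlen := ρ.length_take m
  generalize hσ : ρ.take m = σ at h hlen
  cases h with
  | nil => exact .inl hlen.symm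
  | @uncontrollable σ δ δ' a b e s₁ s₂ h hf hle hs₁ hb hs₂ =>
    obtain ⟨n, rfl⟩ : ∃ n, m = n + 2 := ⟨σ.steps.length, by simp [← hlen, FinRun.snoc]⟩
    rw [InfRun.take_succ] at hσ
    obtain ⟨hσ, h1, -⟩ := FinRun.snoc_inj hσ
    rw [InfRun.take_succ] at hσ
    obtain ⟨rfl, h2, -⟩ := FinRun.snoc_inj hσ
    exact .inr (.inr ⟨n, rfl, h, δ, a, δ', e, hf, h2, h1, .inl ⟨hle, b, hb⟩⟩)
  | @wait σ δ s₁ h hf hs₁ =>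
    obtain ⟨n, rfl⟩ : ∃ n, m = n + 1 := ⟨σ.steps.length, by simp [← hlen, FinRun.snoc]⟩
    rw [InfRun.take_succ] at hσ
    obtain ⟨rfl, h1, -⟩ := FinRun.snoc_inj hσ
    exact .inr (.inl ⟨n, rfl, h, δ, hf, h1⟩)
  | @controllable σ δ c e s₁ s₂ h hf hs₁ hc hs₂ =>
    obtain ⟨n, rfl⟩ : ∃ n, m = n + 2 := ⟨σ.steps.length, by simp [← hlen, FinRun.snoc]⟩
    rw [InfRun.take_succ] at hσ
    obtain ⟨hσ, h1, -⟩ := FinRun.snoc_inj hσ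
    rw [InfRun.take_succ] at hσ
    obtain ⟨rfl, h2, -⟩ := FinRun.snoc_inj hσ
    exact .inr (.inr ⟨n, rfl, h, δ, some c, δ, e, hf, h2, h1, .inr ⟨rfl, c, rfl, hc⟩⟩)

theorem Outcome.complies {s : Config L X} {m : ℕ} (h : Outcome G f s (ρ.take m)) :
    ∀ n < m, WaitsAt f ρ n ∨ ActsAt f ρ n ∨ ∃ k, n = k + 1 ∧ ActsAt f ρ k := by
  induction m using Nat.strong_induction_on with
  | _ m ih =>
    intro n hn
    rcases h.cases_take with rfl | ⟨k, rfl, hk, hw⟩ | ⟨k, rfl, hk, hw⟩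
    · omega
    · rcases (Nat.lt_succ_iff_lt_or_eq.1 hn) with hn | rfl
      · exact ih k (by omega) hk n hn
      · exact .inl hw
    · rcases lt_trichotomy n k with hn' | rfl | hn'
      · exact ih k (by omega) hk n hn'
      · exact .inr (.inl hw)
      · exact .inr (.inr ⟨k, by omega, hw⟩)

theorem InfRun.IsOutcome.complies (h : ρ.IsOutcome f) (n : ℕ) :
    WaitsAt f ρ n ∨ ActsAt f ρ n ∨ ∃ k, n = k + 1 ∧ ActsAt f ρ k := by
  obtain ⟨m, hm, hout⟩ := Filter.frequently_atTop.1 h (n + 1)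
  exact hout.complies n (by omega)

/-- Each extension of an outcome begins with a delay, possibly of length 0, so a transition is
always the second half of a move. -/
theorem InfRun.IsOutcome.exists_delay_before (h : ρ.IsOutcome f) {n : ℕ}
    {e : Edge I O Empty L X} {obs : Set X} (hn : ρ.label n = .edge e obs) :
    ∃ k γ, n = k + 1 ∧ ρ.label k = .delay γ := by
  rcases h.complies n with ⟨δ, -, h'⟩ | ⟨δ, a, γ, e', -, h', -⟩ | ⟨k, rfl, δ, a, γ, e', -, h', -⟩
  · rw [hn] at h'; cases h'
  · rw [hn] at h'; cases h'
  · exact ⟨k, γ, rfl, h'⟩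

theorem InfRun.IsOutcome.exists_delay_after (h : ρ.IsOutcome f) {n : ℕ}
    {e : Edge I O Empty L X} {obs : Set X} (hn : ρ.label n = .edge e obs) :
    ∃ γ, ρ.label (n + 1) = .delay γ := by
  rcases hl : ρ.label (n + 1) with γ | ⟨e', obs'⟩
  · exact ⟨γ, rfl⟩
  · obtain ⟨k, γ, hk, hγ⟩ := h.exists_delay_before hl
    obtain rfl : n = k := by omega
    rw [hn] at hγ; cases hγ

/-- What follows the beginning of a delay of an outcome. -/
theorem InfRun.IsOutcome.cases_delay (h : ρ.IsOutcome f) {n : ℕ} {γ : ℝ≥0}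
    (hn : ρ.label n = .delay γ) : ∃ δ a, f (ρ.take n) = some (δ, a) ∧
      ((γ = δ ∧ a = none ∧ ∃ γ', ρ.label (n + 1) = .delay γ') ∨
        ∃ e, ρ.label (n + 1) = .edge e ∅ ∧ (∃ γ', ρ.label (n + 2) = .delay γ') ∧
          ((γ ≤ δ ∧ ∃ b, e.act = .out b) ∨ (γ = δ ∧ ∃ c, a = some c ∧ e.act = .inp c))) := by
  have acts : ActsAt f ρ n → ∃ δ a, f (ρ.take n) = some (δ, a) ∧
        ∃ e, ρ.label (n + 1) = .edge e ∅ ∧ (∃ γ', ρ.label (n + 2) = .delay γ') ∧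
          ((γ ≤ δ ∧ ∃ b, e.act = .out b) ∨ (γ = δ ∧ ∃ c, a = some c ∧ e.act = .inp c)) := by
    rintro ⟨δ, a, γ', e, hf, h1, h2, h3⟩
    obtain rfl : γ = γ' := by rw [hn] at h1; exact Label.delay.inj h1
    exact ⟨δ, a, hf, e, h2, h.exists_delay_after h2, h3⟩
  rcases h.complies n with ⟨δ, hf, h'⟩ | h' | ⟨k, rfl, δ, a, γ, e', -, -, h', -⟩
  · obtain rfl : γ = δ := by rw [hn] at h'; exact Label.delay.inj h'
    rcases hl : ρ.label (n + 1) with γ' | ⟨e, obs⟩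
    · exact ⟨γ, none, hf, .inl ⟨rfl, rfl, γ', rfl⟩⟩
    · rcases h.complies (n + 1) with ⟨_, -, h''⟩ | ⟨_, _, _, _, -, h'', -⟩ | ⟨k, hk, h''⟩
      · rw [hl] at h''; cases h''
      · rw [hl] at h''; cases h''
      · obtain rfl : n = k := by omega
        obtain ⟨δ, a, hf, H⟩ := acts h''
        rw [hl] at H
        exact ⟨δ, a, hf, .inr H⟩
  · obtain ⟨δ, a, hf, H⟩ := acts h'
    exact ⟨δ, a, hf, .inr H⟩
  · rw [hn] at h'; cases h'

end outcomes

/-! ## Fair outcomes of rank-lowering strategies -/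

section games

variable {I O L X : Type*} {G : TGA I O L X} {pass fail : Set (Config L X)} {M : X → ℕ}
  {f : Strat I O L X} {ρ : InfRun G}

theorem uPred_subset_dPred (V : Set (Config L X)) : uPred G V ⊆ dPred G Set.univ V :=
  fun _ ⟨e, he, _, h⟩ => ⟨e, he, trivial, h⟩

theorem mem_cPred_or_mem_uPred {V : Set (Config L X)} {s : Config L X}
    (h : s ∈ dPred G Set.univ V) : s ∈ cPred G V ∨ s ∈ uPred G V := by
  obtain ⟨e, he, -, h⟩ := h
  rcases hact : e.act with a | a | a
  · exact .inl ⟨e, he, ⟨a, hact.symm⟩, h⟩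
  · exact .inr ⟨e, he, ⟨a, hact.symm⟩, h⟩
  · exact a.elim

theorem step_mem_edges {n : ℕ} {e : Edge I O Empty L X} (hn : ρ.label n = .edge e ∅) :
    e ∈ G.edges ∧ e.src = (ρ.state n).1 ∧ e.guard.Sat (ρ.state n).2 ∧
      ρ.state (n + 1) = (e.tgt, (ρ.state n).2.reset e.reset) := by
  have := ρ.step n
  rw [hn] at this
  obtain ⟨-, -, h1, -, h2, h3, h4⟩ := this
  exact ⟨h1, h2, h3, by simpa using h4⟩

/-- From the `K`-th step on, only regions of the infinite support are visited. -/
def IsTail (M : X → ℕ) (ρ : InfRun G) (K : ℕ) : Prop :=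
  ∀ n ≥ K, region M (ρ.state n) ∈ infSupport M ρ ∧ ∀ γ, ρ.label n = .delay γ → ∀ δ ≤ γ,
    region M ((ρ.state n).shift δ) ∈ infSupport M ρ

/-- Each of the finitely many regions outside the support is visited only finitely often. -/
theorem exists_isTail [Finite X] [Finite L] (M : X → ℕ) (ρ : InfRun G) :
    ∃ K, IsTail M ρ K := by
  let visits : ℕ → Set (Config L X) → Prop := fun i r => ρ.state i ∈ r ∨
    ∃ γ δ, ρ.label i = .delay γ ∧ δ < γ ∧ (ρ.state i).shift δ ∈ r
  have hfin : ((Set.range fun s : Config L X => region M s) \ infSupport M ρ).Finite :=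
    (finite_regions M).sdiff
  have hev : ∀ᶠ i in Filter.atTop,
      ∀ r ∈ (Set.range fun s : Config L X => region M s) \ infSupport M ρ, ¬ visits i r := by
    rw [hfin.eventually_all]
    rintro _ ⟨⟨s, rfl⟩, hr⟩
    rw [← Filter.not_frequently]
    exact fun hfr => hr ⟨⟨s, rfl⟩, hfr⟩
  obtain ⟨K, hK⟩ := Filter.eventually_atTop.1 hev
  have key : ∀ i ≥ K, ∀ s, visits i (region M s) → region M s ∈ infSupport M ρ := by
    intro i hi s hv
    by_contra hs
    exact hK i hi _ ⟨⟨s, rfl⟩, hs⟩ hv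
  have hstate : ∀ n ≥ K, region M (ρ.state n) ∈ infSupport M ρ := fun n hn =>
    key n hn _ (.inl (mem_region_self M _))
  refine ⟨K, fun n hn => ⟨hstate n hn, fun γ hγ δ hδ => ?_⟩⟩
  rcases hδ.lt_or_eq with hδ | rfl
  · exact key n hn _ (.inr ⟨γ, δ, hγ, hδ, mem_region_self M _⟩)
  -- The support counts only instants strictly before the end of a delay; the end is the next state.
  · rw [← InfRun.state_succ_of_delay hγ]
    exact hstate _ (by omega)

theorem bddAbove_progress [Finite X] (M : X → ℕ) : BddAbove (Set.range (progress M)) := by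
  refine ⟨Nat.card (Σ x, Fin (M x + 1)) + Nat.card (Σ x, Fin (M x + 1)), ?_⟩
  rintro _ ⟨v, rfl⟩
  exact Nat.add_le_add (Set.ncard_le_card _) (Set.ncard_le_card _)

/-- An infinite fair outcome of a rank-lowering strategy that avoids `fail`, in a game without
invariants in which all clocks are proper. -/
structure FairPlay (G : TGA I O L X) (pass fail : Set (Config L X)) (M : X → ℕ)
    (f : Strat I O L X) (ρ : InfRun G) : Prop where
  mem_configs : ∀ s, s ∈ G.configs
  bounded : ∀ e ∈ G.edges, e.guard.BoundedBy M
  closed_pass : RegClosed M pass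
  closed_fail : RegClosed M fail
  convex : ∀ s ∉ fail, ∀ d e : ℝ≥0, d ≤ e → s.shift e ∉ fail → s.shift d ∉ fail
  avoids : ∀ n, ρ.state n ∉ fail
  det : ∀ n, ∀ e ∈ G.edges, ∀ e' ∈ G.edges, ∀ c, e.act = .inp c → e'.act = .inp c →
    e.src = (ρ.state n).1 → e'.src = (ρ.state n).1 → e.guard.Sat (ρ.state n).2 →
    e'.guard.Sat (ρ.state n).2 →
      e.tgt = e'.tgt ∧ (ρ.state n).2.reset e.reset = (ρ.state n).2.reset e'.reset
  live : ∀ n, ∃ d, ∃ e ∈ G.edges, e.src = (ρ.state n).1 ∧ e.guard.Sat ((ρ.state n).shift d).2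
  ranked : ∀ n, ∃ j, ρ.state n ∈ WInf G pass fail j
  rankLowering : RankLowering G pass fail M f
  outcome : ρ.IsOutcome f
  fair : Fair M ρ

namespace FairPlay

/-- What happens during and after a delay from a configuration that has a rank. -/
theorem next (h : FairPlay G pass fail M f ρ) {n j i : ℕ} {γ : ℝ≥0} (hn : ρ.label n = .delay γ)
    (hr : HasRank G pass fail (ρ.state n) j i) {V : Set (Config L X)}
    (hV : WMinus G pass fail j i = V) : ∃ δ, γ ≤ δ ∧
      (∀ δ' ∈ candidates G V (ρ.state n), δ' ≤ δ →
        RegEq M ((ρ.state n).2.shift δ) ((ρ.state n).2.shift δ')) ∧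
      (candidates G V (ρ.state n) = ∅ → ∀ δ', δ ≤ δ' →
        RegEq M ((ρ.state n).2.shift δ) ((ρ.state n).2.shift δ')) ∧
      ((γ = δ ∧ (∃ γ', ρ.label (n + 1) = .delay γ') ∧
          ((candidates G V (ρ.state n)).Nonempty → ρ.state (n + 1) ∈ V)) ∨
        (γ = δ ∧ (candidates G V (ρ.state n)).Nonempty ∧
          (∃ γ', ρ.label (n + 2) = .delay γ') ∧ ρ.state (n + 2) ∈ V) ∨
        ((ρ.label (n + 1)).Uncontrollable ∧ (∃ γ', ρ.label (n + 2) = .delay γ') ∧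
          ∀ U, (ρ.state n).shift γ ∉ uPred G Uᶜ → ρ.state (n + 2) ∈ U)) := by
  subst hV
  obtain ⟨δ, a, hf, hne, hem⟩ := h.rankLowering (ρ.take n) (ρ.isRun_take n)
    (by rw [ρ.last_take]; exact h.avoids n) j i (by rw [ρ.last_take]; exact hr)
  rw [ρ.last_take] at hne hem
  obtain ⟨δ₀, a₀, hf₀, H⟩ := h.outcome.cases_delay hn
  obtain ⟨rfl, rfl⟩ : δ = δ₀ ∧ a = a₀ := by
    rw [hf] at hf₀; simpa using hf₀
  have hst := InfRun.state_succ_of_delay hn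
  refine ⟨δ, ?_, fun δ' hδ' => (hne ⟨δ', hδ'⟩).2.2 δ' hδ', fun h0 => (hem h0).2, ?_⟩
  · rcases H with ⟨rfl, -⟩ | ⟨-, -, -, ⟨h', -⟩ | ⟨rfl, -⟩⟩
    exacts [le_rfl, h', le_rfl]
  · rcases H with ⟨rfl, rfl, hl⟩ | ⟨e, he, hl, ⟨hle, b, hb⟩ | ⟨rfl, c, rfl, hc⟩⟩
    · refine .inl ⟨rfl, hl, fun h0 => ?_⟩
      rw [hst]
      exact (hne h0).2.1 rfl
    · refine .inr (.inr ⟨?_, hl, fun U hU => ?_⟩)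
      · rw [he]; exact ⟨b, hb⟩
      · obtain ⟨h1, h2, h3, h4⟩ := step_mem_edges he
        rw [hst] at h2 h3 h4
        by_contra h5
        rw [h4] at h5
        exact hU ⟨e, h1, ⟨b, hb.symm⟩, h2, h3, h5⟩
    · have h0 : (candidates G (WMinus G pass fail j i) (ρ.state n)).Nonempty := by
        rw [Set.nonempty_iff_ne_empty]
        intro h0
        exact absurd (hem h0).1 (by simp)
      refine .inr (.inl ⟨rfl, h0, hl, ?_⟩)
      obtain ⟨e', he', hact', hsrc', hg', hV'⟩ := (hne h0).1 c rfl
      obtain ⟨h1, h2, h3, h4⟩ := step_mem_edges he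
      rw [← hst] at hsrc' hg' hV'
      obtain ⟨h5, h6⟩ := h.det (n + 1) e h1 e' he' c hc hact' h2 hsrc' h3 hg'
      rw [h4, h5, h6]
      exact hV'

/-- Fairness with respect to the uncontrollable actions. -/
theorem region_mem_infSupport (h : FairPlay G pass fail M f ρ) {t u : Config L X} (ht : region M t ∈ infSupport M ρ)
    {e : Edge I O Empty L X} (he : e ∈ G.edges) {b : O} (hb : e.act = .out b)
    (hsrc : e.src = u.1) (hg : e.guard.Sat u.2) (hu : u ∈ region M t) :
    region M (e.tgt, u.2.reset e.reset) ∈ infSupport M ρ :=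
  h.fair.1 e he ⟨b, hb⟩ _ ht u hu _
    ⟨h.mem_configs _, h.mem_configs _, he, Set.empty_subset _, hsrc, hg, by simp⟩

/-- Fairness with respect to the controllable actions and delays. -/
theorem exists_play (h : FairPlay G pass fail M f ρ) {t : Config L X} (ht : region M t ∈ infSupport M ρ) (N : ℕ) :
    ∃ n ≥ N, ∃ γ, ρ.label n = .delay γ ∧ ∃ δ ≤ γ, (ρ.state n).shift δ ∈ region M t ∧
      ((∃ δ', δ < δ' ∧ δ' ≤ γ ∧ (ρ.state n).shift δ' ∉ region M t) ∨
        (δ = γ ∧ ¬ (ρ.label (n + 1)).Uncontrollable)) := by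
  -- The bound `N + 1` leaves room for the delay that precedes a controllable transition.
  obtain ⟨k, hk, hp⟩ := Filter.frequently_atTop.1 (h.fair.2 _ ht) (N + 1)
  rcases hp with ⟨hmem, hc⟩ | ⟨γ, hγ, ⟨δ, δ', h1, h2, h3, h4⟩ | ⟨h1, h2⟩⟩
  · rcases hl : ρ.label k with γ | ⟨e, obs⟩
    · rw [hl] at hc; exact hc.elim
    · obtain ⟨n, γ, rfl, hγ⟩ := h.outcome.exists_delay_before hl
      refine ⟨n, by omega, γ, hγ, γ, le_rfl, ?_, .inr ⟨rfl, ?_⟩⟩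
      · rwa [← InfRun.state_succ_of_delay hγ]
      · rw [hl] at hc ⊢
        obtain ⟨c, hc⟩ := hc
        rintro ⟨b, hb⟩
        rw [hc] at hb; cases hb
  · exact ⟨k, by omega, γ, hγ, δ, h1.le.trans h2, h3, .inl ⟨δ', h1, h2, h4⟩⟩
  · refine ⟨k, by omega, γ, hγ, γ, le_rfl, ?_, .inr ⟨rfl, h2⟩⟩
    rwa [← InfRun.state_succ_of_delay hγ]

/-- If a region of the infinite support is contained in `W^j_∞` then some decision is made in
`W^j_∞`. -/
theorem exists_delay_mem_WInf [Finite X] (h : FairPlay G pass fail M f ρ) (K : ℕ) {j : ℕ}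
    {t : Config L X} (ht : region M t ∈ infSupport M ρ)
    (htj : t ∈ WInf G pass fail j) :
    ∃ n ≥ K, (∃ γ, ρ.label n = .delay γ) ∧ ρ.state n ∈ WInf G pass fail j := by
  have hcl := RegClosed.WInf (j := j) h.bounded h.closed_pass h.closed_fail
  obtain ⟨n, hn, γ, hγ, δ₁, hδ₁, hmem, hplay⟩ := h.exists_play ht K
  by_cases hs : ρ.state n ∈ WInf G pass fail j
  · exact ⟨n, hn, ⟨γ, hγ⟩, hs⟩
  have hp : (ρ.state n).shift δ₁ ∈ WInf G pass fail j := hcl t htj _ hmem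
  -- Otherwise the configuration has rank `(j + 1, 0)`, so the strategy aims at `W^j_∞`, and `δ₁` is
  -- a candidate delay.
  have h0 : ρ.state n ∈ W G pass fail (j + 1) 0 := by
    rw [WBase_succ]; exact tPred_of_mem δ₁ (.inl hp)
  have hrank : HasRank G pass fail (ρ.state n) (j + 1) 0 :=
    ⟨⟨W_subset_WInf _ _ h0, fun j' hj' hmem => hs (WInf_mono (Nat.lt_succ_iff.1 hj') hmem)⟩, h0,
      fun i' hi' => absurd hi' (Nat.not_lt_zero _)⟩
  have hcand : δ₁ ∈ candidates G (WInf G pass fail j) (ρ.state n) := .inr hp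
  obtain ⟨δ, hle, hmin, -, hcases⟩ := h.next hγ hrank rfl
  rcases hplay with ⟨δ₂, h12, h2, hout⟩ | ⟨rfl, hunc⟩
  · refine absurd ?_ hout
    -- Since `δ₁` is already a candidate, minimality keeps all later instants of the delay in the
    -- region of `δ₁`, so the delay cannot leave it.
    have := (hmin δ₁ hcand (hδ₁.trans hle)).symm.of_le h12.le (h2.trans hle)
    exact ⟨hmem.1, hmem.2.trans this⟩
  · rcases hcases with ⟨-, hl, hV⟩ | ⟨-, -, hl, hV⟩ | ⟨hu, -⟩
    · exact ⟨n + 1, by omega, hl, hV ⟨_, hcand⟩⟩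
    · exact ⟨n + 2, by omega, hl, hV⟩
    · exact absurd hu hunc

/-- Decisions made in `W^j_∞` lead to `W^j_0`. -/
theorem exists_mem_W_zero [Finite X] (h : FairPlay G pass fail M f ρ) {K j : ℕ}
    (hK : IsTail M ρ K)
    (hj : ∀ m < j, ∀ s, region M s ∈ infSupport M ρ → s ∉ WInf G pass fail m) (i : ℕ) : ∀ n ≥ K, (∃ γ, ρ.label n = .delay γ) →
    ρ.state n ∈ W G pass fail j i → ∃ n' ≥ K, ρ.state n' ∈ W G pass fail j 0 := by
  induction i using Nat.strong_induction_on with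
  | _ i ih =>
  rintro n hn ⟨γ, hγ⟩ hs
  rcases i with _ | i
  · exact ⟨n, hn, hs⟩
  -- If `W^j_0` is never met in the tail, the induction hypothesis excludes decisions of smaller
  -- index, so a decision in `W^j_{i+1}` has exact rank `(j, i + 1)`.
  by_contra hno
  have hV : ∀ i' < i + 1, ∀ m ≥ K, (∃ γ, ρ.label m = .delay γ) → ρ.state m ∉ W G pass fail j i' :=
    fun i' hi' m hm hl hmem => hno (ih i' hi' m hm hl hmem)
  have hlow : ∀ m ≥ K, ∀ j' < j, ρ.state m ∉ WInf G pass fail j' :=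
    fun m hm j' hj' => hj j' hj' _ (hK m hm).1
  have hrank : ∀ m ≥ K, (∃ γ, ρ.label m = .delay γ) → ρ.state m ∈ W G pass fail j (i + 1) →
      HasRank G pass fail (ρ.state m) j (i + 1) := fun m hm hl hmem =>
    ⟨⟨W_subset_WInf _ _ hmem, hlow m hm⟩, hmem, fun i' hi' => hV i' hi' m hm hl⟩
  set V := W G pass fail j i with hVdef
  replace hV := hV i (Nat.lt_succ_self i)
  have hclV : RegClosed M V := RegClosed.W h.bounded h.closed_pass h.closed_fail j i
  have hclU : RegClosed M (uPred G Vᶜ) := RegClosed.dPred h.bounded _ hclV.compl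
  obtain ⟨δ, hle, hmin, hmax, hcases⟩ := h.next (V := V) hγ (hrank n hn ⟨γ, hγ⟩ hs) rfl
  have hstep := InfRun.state_succ_of_delay hγ
  have hsγ : (ρ.state n).shift γ ∉ fail := by rw [← hstep]; exact h.avoids _
  have hs' := hs
  rw [W_succ, ← hVdef] at hs'
  rcases hs' with ⟨δ₀, hδ₀, hav⟩ | ⟨δ₀, hδ₀, hav⟩ | hc
  -- First clause of `π`: a candidate exists. An output after `δ₀` is harmless too, since by
  -- minimality the region is still that of `δ₀`.
  · have hcand : δ₀ ∈ candidates G V (ρ.state n) := hδ₀.symm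
    rcases hcases with ⟨-, hl, hW⟩ | ⟨-, -, hl, hW⟩ | ⟨-, hl, hW⟩
    · exact hV (n + 1) (by omega) hl (hW ⟨_, hcand⟩)
    · exact hV (n + 2) (by omega) hl hW
    · refine hV (n + 2) (by omega) hl (hW V ?_)
      rcases le_or_gt γ δ₀ with hγ₀ | hγ₀
      · exact hav γ hγ₀
      · have h1 := (hmin δ₀ hcand (hγ₀.le.trans hle)).symm.of_le hγ₀.le hle
        exact fun hmem => hav δ₀ le_rfl (hclU _ hmem _ ⟨rfl, h1.symm⟩)
  · have hγ₀ : γ < δ₀ := by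
      by_contra hγ₀
      exact h.convex _ (h.avoids n) δ₀ γ (not_lt.1 hγ₀) hsγ hδ₀
    rcases hcases with ⟨rfl, hl, hW⟩ | ⟨-, -, hl, hW⟩ | ⟨-, hl, hW⟩
    · rcases (candidates G V (ρ.state n)).eq_empty_or_nonempty with h0 | h0
      · have h1 := hmax h0 δ₀ hγ₀.le
        exact hsγ (h.closed_fail _ hδ₀ _ ⟨rfl, h1.symm⟩)
      · exact hV (n + 1) (by omega) hl (hW h0)
    · exact hV (n + 2) (by omega) hl hW
    · exact hV (n + 2) (by omega) hl (hW V (hav γ hγ₀.le))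
  -- Third clause: no transition available later leads outside `V`.
  · have hc' : ∀ d, (ρ.state n).shift d ∉ dPred G Set.univ Vᶜ :=
      fun d hd => hc (tPred_of_mem d hd)
    rcases (candidates G V (ρ.state n)).eq_empty_or_nonempty with h0 | h0
    · have hcand : ∀ d, (ρ.state n).shift d ∉ cPred G V ∪ V := fun d hd => by
        have : d ∈ candidates G V (ρ.state n) := hd
        rw [h0] at this; exact this
      have hstuck : ∀ k, (∃ γ, ρ.label (n + k) = .delay γ) ∧
          ∃ d, ρ.state (n + k) = (ρ.state n).shift d := by
        intro k
        induction k with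
        | zero => exact ⟨⟨γ, hγ⟩, 0, by simp⟩
        | succ k ihk =>
          obtain ⟨⟨γ', hγ'⟩, d, hd⟩ := ihk
          have hmem : ρ.state (n + k) ∈ W G pass fail j (i + 1) := by
            rw [W_succ, ← hVdef, hd]
            refine .inr (.inr ?_)
            rintro ⟨d', hd', -⟩
            rw [Config.shift_shift] at hd'
            exact hc' _ hd'
          have h0' : ¬ (candidates G V (ρ.state (n + k))).Nonempty := by
            rintro ⟨d', hd'⟩
            have hd' : (ρ.state (n + k)).shift d' ∈ cPred G V ∪ V := hd'
            rw [hd, Config.shift_shift] at hd'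
            exact hcand _ hd'
          obtain ⟨_, -, -, -, hnext⟩ := h.next (V := V) hγ'
            (hrank (n + k) (by omega) ⟨γ', hγ'⟩ hmem) rfl
          rcases hnext with ⟨-, hl, -⟩ | ⟨-, hne, -⟩ | ⟨-, hl, hW⟩
          · refine ⟨hl, d + γ', ?_⟩
            rw [← Config.shift_shift, ← hd]
            exact InfRun.state_succ_of_delay hγ'
          · exact absurd hne h0'
          · refine absurd (hW V fun hU => ?_) (hV (n + k + 2) (by omega) hl)
            rw [hd, Config.shift_shift] at hU
            exact hc' _ (uPred_subset_dPred _ hU)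
      have hγδ : γ = δ := by
        obtain ⟨γ', hγ'⟩ := (hstuck 1).1
        rcases hcases with ⟨h1, -⟩ | ⟨h1, -⟩ | ⟨h1, -⟩
        · exact h1
        · exact h1
        · rw [hγ'] at h1; exact h1.elim
      subst hγδ
      -- Some transition is enabled now or later, and leads into `V`. An input would be a candidate;
      -- an output is enabled throughout the final region, so fairness puts its target in the
      -- support, whereas the run only delays from step `n` and never meets `V`.
      obtain ⟨d, e, he, hsrc, hg⟩ := h.live (n + 1)
      rw [hstep] at hsrc hg
      rw [Config.shift_shift] at hg
      set u : Config L X := (e.tgt, ((ρ.state n).shift (γ + d)).2.reset e.reset) with hu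
      have huV : u ∈ V := by
        by_contra huV
        exact hc' (γ + d) ⟨e, he, trivial, hsrc, hg, huV⟩
      rcases hact : e.act with c | b | a
      · exact hcand (γ + d) (.inl ⟨e, he, ⟨c, hact.symm⟩, hsrc, hg, huV⟩)
      · have hinf : region M u ∈ infSupport M ρ := by
          refine h.region_mem_infSupport (hK (n + 1) (by omega)).1 he hact hsrc hg ?_
          rw [hstep]
          exact ⟨rfl, hmax h0 (γ + d) le_self_add⟩
        obtain ⟨k, hk, hvis⟩ := Filter.frequently_atTop.1 hinf.2 n
        obtain ⟨k, rfl⟩ := Nat.exists_eq_add_of_le hk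
        obtain ⟨-, d', hd'⟩ := hstuck k
        rcases hvis with hvis | ⟨-, ε, -, -, hvis⟩
        · rw [hd'] at hvis
          exact hcand _ (.inr (hclV _ huV _ hvis))
        · rw [hd', Config.shift_shift] at hvis
          exact hcand _ (.inr (hclV _ huV _ hvis))
      · exact a.elim
    · rcases hcases with ⟨-, hl, hW⟩ | ⟨-, -, hl, hW⟩ | ⟨-, hl, hW⟩
      · exact hV (n + 1) (by omega) hl (hW h0)
      · exact hV (n + 2) (by omega) hl hW
      · exact hV (n + 2) (by omega) hl (hW V fun hU => hc' _ (uPred_subset_dPred _ hU))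

/-- If the infinite support meets `W^{m+1}_0` then it meets `W^m_∞`. -/
theorem exists_mem_WInf_of_mem_W_zero (h : FairPlay G pass fail M f ρ) [Finite X] {K m : ℕ}
    (hK : IsTail M ρ K)
    {t : Config L X} (ht : region M t ∈ infSupport M ρ) (ht0 : t ∈ W G pass fail (m + 1) 0) :
    ∃ s, region M s ∈ infSupport M ρ ∧ s ∈ WInf G pass fail m := by
  by_contra! hnot
  set V := WInf G pass fail m with hVdef
  have hclV : RegClosed M V := RegClosed.WInf h.bounded h.closed_pass h.closed_fail m
  have hcl0 : RegClosed M (W G pass fail (m + 1) 0) :=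
    RegClosed.W h.bounded h.closed_pass h.closed_fail (m + 1) 0
  -- Among the regions of the support inside `W^{m+1}_0`, one that is latest with respect to time: a
  -- delay leaving it within the run also leaves `W^{m+1}_0`.
  obtain ⟨q, ⟨hq, hq0⟩, hqmax⟩ : ∃ q, (region M q ∈ infSupport M ρ ∧
      q ∈ W G pass fail (m + 1) 0) ∧ ∀ q', region M q' ∈ infSupport M ρ →
        q' ∈ W G pass fail (m + 1) 0 → progress M q'.2 ≤ progress M q.2 := by
    set A : Set ℕ := (fun q : Config L X => progress M q.2) ''
      {q | region M q ∈ infSupport M ρ ∧ q ∈ W G pass fail (m + 1) 0}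
    have hA : A.Nonempty := ⟨_, t, ⟨ht, ht0⟩, rfl⟩
    have hB : BddAbove A := (bddAbove_progress M).mono (by rintro _ ⟨q, -, rfl⟩; exact ⟨_, rfl⟩)
    obtain ⟨q, hq, hqA⟩ := Nat.sSup_mem hA hB
    exact ⟨q, hq, fun q' h1 h2 => (le_csSup hB ⟨q', ⟨h1, h2⟩, rfl⟩).trans hqA.ge⟩
  obtain ⟨n, hn, γ, hγ, δ₁, hδ₁, hmem, hplay⟩ := h.exists_play hq K
  have hp0 := hcl0 q hq0 _ hmem
  rw [WBase_succ] at hp0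
  obtain ⟨ε, hε, -⟩ := hp0
  rw [Config.shift_shift, ← hVdef] at hε
  have h0 : ρ.state n ∈ W G pass fail (m + 1) 0 := by
    rw [WBase_succ]; exact tPred_of_mem _ hε
  have hrank : HasRank G pass fail (ρ.state n) (m + 1) 0 :=
    ⟨⟨W_subset_WInf _ _ h0, fun j' hj' hmem => hnot _ (hK n hn).1
      (WInf_mono (Nat.lt_succ_iff.1 hj') hmem)⟩, h0, fun i' hi' => absurd hi' (Nat.not_lt_zero _)⟩
  obtain ⟨δ, hle, hmin, hmax, hcases⟩ := h.next (V := V) hγ hrank rfl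
  set p := (ρ.state n).shift δ₁ with hp
  have hpinf : region M p ∈ infSupport M ρ := by rw [region_eq_of_mem hmem]; exact hq
  -- The support misses `V`, and by fairness no output from `p` leads into `V`; so only an input
  -- can, which makes `δ₁` a candidate.
  have hpcand : p ∈ V ∪ dPred G Set.univ V → δ₁ ∈ candidates G V (ρ.state n) := by
    rintro (hpV | hpV)
    · exact absurd hpV (hnot p hpinf)
    · rcases mem_cPred_or_mem_uPred hpV with hpc | ⟨e, he, ⟨b, hb⟩, hsrc, hg, hu⟩
      · exact .inl hpc
      · exact absurd hu (hnot _ (h.region_mem_infSupport hpinf he hb.symm hsrc hg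
          (mem_region_self M p)))
  have hclY : RegClosed M (V ∪ dPred G Set.univ V) := hclV.union (hclV.dPred h.bounded _)
  rcases hplay with ⟨δ₂, h12, h2, hout⟩ | ⟨rfl, hunc⟩
  · have hlater : ∀ δ', δ₁ ≤ δ' → δ' ≤ γ → (ρ.state n).shift δ' ∈ W G pass fail (m + 1) 0 →
        RegEq M p.2 ((ρ.state n).shift δ').2 := by
      intro δ' h1 h2 h3
      have h4 := hqmax _ ((hK n hn).2 γ hγ δ' h2) h3
      rw [progress_congr hmem.2, ← Config.shift_sub _ h1] at h4
      have := regEq_shift_of_progress_le h4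
      rw [← Config.shift_sub _ h1]
      exact this
    -- Up to `δ₁ + ε` the delay stays in `W^{m+1}_0`, hence in the region of `q`; leaving that
    -- region must come later.
    have hlt : δ₁ + ε < δ₂ := by
      by_contra hlt
      refine hout ⟨hmem.1, hmem.2.trans (hlater δ₂ h12.le h2 ?_)⟩
      rw [WBase_succ]
      refine tPred_of_mem (δ₁ + ε - δ₂) ?_
      rw [Config.shift_sub _ (not_lt.1 hlt)]
      exact hε
    have h3 : RegEq M p.2 ((ρ.state n).shift (δ₁ + ε)).2 := by
      refine hlater (δ₁ + ε) le_self_add (hlt.le.trans h2) ?_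
      rw [WBase_succ]
      exact tPred_of_mem 0 (by rw [Config.shift_zero]; exact hε)
    have hcand := hpcand (hclY _ hε _ ⟨rfl, h3.symm⟩)
    have := (hmin δ₁ hcand (hδ₁.trans hle)).symm.of_le h12.le (h2.trans hle)
    exact hout ⟨hmem.1, hmem.2.trans this⟩
  · rcases hcases with ⟨rfl, -, hV⟩ | ⟨-, -, -, hV⟩ | ⟨hu, -⟩
    · rcases (candidates G V (ρ.state n)).eq_empty_or_nonempty with he | hne
      · have h3 := hmax he (δ₁ + ε) le_self_add
        have hcand := hpcand (hclY _ hε _ ⟨rfl, h3.symm⟩)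
        rw [he] at hcand
        exact hcand
      · exact hnot _ (hK (n + 1) (by omega)).1 (hV hne)
    · exact hnot _ (hK (n + 2) (by omega)).1 hV
    · exact hunc hu

/-- A fair outcome of a rank-lowering strategy that avoids `fail` reaches `pass`. -/
theorem exists_mem_pass (h : FairPlay G pass fail M f ρ) [Finite X] [Finite L] : ∃ n, ρ.state n ∈ pass := by
  classical
  obtain ⟨K, hK⟩ := exists_isTail M ρ
  have hex : ∃ j, ∃ s, region M s ∈ infSupport M ρ ∧ s ∈ WInf G pass fail j := by
    obtain ⟨j, hj⟩ := h.ranked K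
    exact ⟨j, _, (hK K le_rfl).1, hj⟩
  have hj : ∀ m < Nat.find hex, ∀ s, region M s ∈ infSupport M ρ → s ∉ WInf G pass fail m :=
    fun m hm s hs hmem => Nat.find_min hex hm ⟨s, hs, hmem⟩
  obtain ⟨t, ht, htj⟩ := Nat.find_spec hex
  obtain ⟨n, hn, hl, hmem⟩ := h.exists_delay_mem_WInf K ht htj
  obtain ⟨i, hi⟩ := Set.mem_iUnion.1 hmem
  obtain ⟨n', hn', hmem'⟩ := h.exists_mem_W_zero hK hj i n hn hl hi
  rcases hzero : Nat.find hex with _ | m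
  · rw [hzero] at hmem'
    exact ⟨n', hmem'⟩
  · rw [hzero] at hmem'
    obtain ⟨s, hs, hsm⟩ := h.exists_mem_WInf_of_mem_W_zero hK (hK n' hn').1 hmem'
    exact absurd hsm (hj m (by omega) s hs)

end FairPlay

end games

end TimedTesting

/-! ### The tester satisfies the hypotheses of the abstract game argument -/

theorem mainTheorem1 {In Out Tau LS XS LT XT LD XD : Type*}
    [Finite In] [Finite Out] [Finite Tau] [Finite LS] [Finite XS] [Finite LT] [Finite XT]
    [Finite LD] [Finite XD]
    (S : OTAIO (Option In) Out Tau LS XS) (hS : IsSpecification S)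
    (P : OTAIO (Option In) Out Tau LT (XT ⊕ XS)) (AccP : Set LT) (hP : IsTestPurpose P)
    (D : OTAIO (Option In) Out Empty LD XD) (AccD : Set LD)
    (hD : IsExactDeterminization (product S P) {l | l.2 ∈ AccP} D AccD)
    (hdet : GuardDeterministic D)
    (C : OutputComplement D)
    (hpass : ∃ s ∈ passSet D AccD, ReachAvoiding (tester D C) (failSet D) s)
    (M : XD → ℕ) (hMinv : ∀ l, (D.inv l).BoundedBy M)
    (hMedges : ∀ e ∈ (tester D C).edges, e.guard.BoundedBy M)
    (f : Strat (Option In) Out (Option LD) XD) (hf : IsStrategy (tester D C) f)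
    (hrank : RankLowering (tester D C) (passSet D AccD) (failSet D) M f)
    (ρ : InfRun (tester D C)) (hout : ρ.IsOutcome f) (hfair : Fair M ρ) :
    ρ.Reaches (passSet D AccD ∪ failSet D) := by
  have hDp := hD.proper_eq_univ
  by_contra hnot
  have hnf : ∀ n, ρ.state n ∉ failSet D := fun n hn => hnot ⟨n, .inr hn⟩
  have hnp : ∀ n, ρ.state n ∉ passSet D AccD := fun n hn => hnot ⟨n, .inl hn⟩
  have hreach : ∀ n, ReachableIn D (ρ.state n) := by
    intro n
    induction n with
    | zero => rw [ρ.state_zero]; exact ⟨D.init, rfl, OTAIO.Reach.init⟩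
    | succ n ih => exact ih.step hDp (ρ.step n) (hnf (n + 1))
  have hacc := exists_reach_accepting hDp hpass
  have hinp : ∀ n l, (ρ.state n).1 = some l → ∀ e ∈ (tester D C).edges, ∀ c, e.act = .inp c →
      e.src = (ρ.state n).1 → ∃ e' ∈ D.edges, e = liftEdge e' ∧ e'.src = l := by
    rintro n l hl e he c hc hsrc
    rw [hl] at hsrc
    rcases he with (⟨e', he', rfl⟩ | he) | ⟨a, rfl⟩
    · exact ⟨e', he', rfl, Option.some.inj hsrc⟩
    · obtain ⟨p, g, -, rfl⟩ := Set.mem_iUnion.1 he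
      cases hc
    · cases hsrc
  have hplay : FairPlay (tester D C) (passSet D AccD) (failSet D) M f ρ :=
    { mem_configs := mem_configs_tester
      bounded := hMedges
      closed_pass := regClosed_passSet hMinv
      closed_fail := regClosed_failSet hMinv
      convex := fun s hs d e hde he => not_mem_failSet_of_le hs he hde
      avoids := hnf
      det := by
        intro n e he e' he' c hc hc' hsrc hsrc' hg hg'
        obtain ⟨l, hl, hr⟩ := hreach n
        obtain ⟨e, heD, rfl, h1⟩ := hinp n l hl e he c hc hsrc
        obtain ⟨e', heD', rfl, h2⟩ := hinp n l hl e' he' c hc' hsrc'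
        obtain ⟨h3, h4⟩ := hdet _ hr e heD e' heD' h1 h2 (hc.trans hc'.symm) hg hg'
        exact ⟨congrArg some h3, h4⟩
      live := by
        intro n
        obtain ⟨l, hl, hr⟩ := hreach n
        obtain ⟨μ, u, hμ, hu⟩ := exists_path_accepting hS hP hD hacc hr
        -- The path to an accepting location must change location: an accepting location outside
        -- Fail is already Pass. Hence some transition becomes enabled after a delay.
        have hne : l ≠ u.1 := by
          rintro rfl
          exact hnp n (mem_passSet_of_mem_accepting hl hu (hnf n))
        obtain ⟨d, e, obs, t, -, -, he, -, hsrc, hg, -⟩ := hμ.exists_edge hne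
        refine ⟨d, liftEdge e, .inl (.inl ⟨e, he, rfl⟩), ?_, hg⟩
        rw [hl]; exact congrArg some hsrc
      ranked := by
        intro n
        obtain ⟨l, hl, hr⟩ := hreach n
        obtain ⟨μ, u, hμ, hu⟩ := exists_path_accepting hS hP hD hacc hr
        obtain ⟨j, hj⟩ := mem_WInf_of_path (C := C) hDp hμ hu
        refine ⟨j, ?_⟩
        have : ρ.state n = (some l, (ρ.state n).2) := Prod.ext hl rfl
        rw [this]; exact hj
      rankLowering := hrank
      outcome := hout
      fair := hfair }
  obtain ⟨n, hn⟩ := hplay.exists_mem_pass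
  exact hnp n hn
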